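/- Let $k$ be any field. An endomorphism $f=(f_1,\dots,f_n)$ of $\mathbb{A}^n=\mathbb{A}^n_k$ is an $n$-tuple of polynomials in $k[x_1,\dots,x_n]$; it is an automorphism if it is invertible for composition, and $\deg f=\max_i\deg f_i$. The dynamical degree of $f$ is $\lim_{r\to\infty}\deg(f^r)^{1/r}$. An endomorphism $\tau$ is triangular if $\tau_i\in k[x_1,\dots,x_i]$ for all $i$; $f$ is affine-triangular (respectively permutation-triangular) if $f=\alpha\circ\tau$ with $\tau$ triangular and $\alpha$ an automorphism of degree $1$ (respectively a permutation of the coordinates). An endomorphism of $\mathbb{A}^{n+1}$ is shift-like if it has the form $(x_{n+1}+p(x_1,\dots,x_n),x_1,\dots,x_n)$ with $p\in k[x_1,\dots,x_n]$. A weak Perron number is a real algebraic integer $\lambda\ge 1$ all of whose Galois conjugates $\mu\in\mathbb{C}$ satisfy $|\mu|\le\lambda$. **Proposition.** Let $\lambda\in\mathbb{R}$ be a weak Perron number that is a quadratic integer, with minimal polynomial $x^2-ax-b$, where $a,b\in\mathbb{Z}$. Then $a\ge 0$, and the following hold. 1. If $b\ge 0$, then $\lambda$ is the dynamical degree of the shift-like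 automorphism $(x_3+x_1^a x_2^b,\,x_1,\,x_2)$ of $\mathbb{A}^3$. 2. If $b<0$, then $\lambda$ is not the dynamical degree of any affine-triangular automorphism of $\mathbb{A}^3$. However, put $\alpha=\lfloor a/2\rfloor$ and $$A=(a_{i,j})=\begin{pmatrix}\alpha & 1\\ \alpha(a-\alpha)+b & a-\alpha\end{pmatrix}.$$ Then $A$ has non-negative integer entries, is irreducible, has spectral radius greater than $1$, and $\lambda$ is the dynamical degree of $$\left(x_3+x_1^{a_{1,1}}x_2^{a_{1,2}},\;x_4+x_1^{a_{2,1}}x_2^{a_{2,2}},\;x_1,\;x_2\right)=\left(x_3+x_1^{\alpha}x_2,\;x_4+x_1^{\alpha(a-\alpha)+b}x_2^{a-\alpha},\;x_1,\;x_2\right),$$ which is a permutation-triangular automorphism of $\mathbb{A}^4$. -/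

import Mathlib

open MvPolynomial Filter Topology

/-- Endomorphisms `f = (f_1, …, f_n)` of the affine space of dimension `n` over `k`,
identified with `n`-tuples of polynomials in `n` variables. The variable written `x_i` on paper
is `X (i - 1)`, since `Fin n` starts at `0`. -/
abbrev AffEnd (k : Type*) [Field k] (n : ℕ) : Type _ := Fin n → MvPolynomial (Fin n) k

namespace AffEnd

noncomputable section

/-- The identity `(x_1, …, x_n)`. -/
def one (k : Type*) [Field k] (n : ℕ) : AffEnd k n := fun i => X i

/-- The composition `f ∘ g = (f_1(g_1, …, g_n), …, f_n(g_1, …, g_n))`. -/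
def comp {k : Type*} [Field k] {n : ℕ} (f g : AffEnd k n) : AffEnd k n :=
  fun i => aeval g (f i)

/-- The iterate `f^r = f ∘ ⋯ ∘ f`. -/
def iter {k : Type*} [Field k] {n : ℕ} (f : AffEnd k n) : ℕ → AffEnd k n
  | 0 => one k n
  | r + 1 => comp f (iter f r)

/-- `deg f = max (deg f_1, …, deg f_n)`. -/
def deg {k : Type*} [Field k] {n : ℕ} (f : AffEnd k n) : ℕ :=
  Finset.univ.sup fun i => (f i).totalDegree

/-- `f` is invertible in the monoid of endomorphisms. -/
def IsAutomorphism {k : Type*} [Field k] {n : ℕ} (f : AffEnd k n) : Prop :=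
  ∃ g : AffEnd k n, comp f g = one k n ∧ comp g f = one k n

/-- `l` is the dynamical degree of `f`, that is, the limit of `deg (f^r)^(1/r)`. -/
def IsDynamicalDegree {k : Type*} [Field k] {n : ℕ} (f : AffEnd k n) (l : ℝ) : Prop :=
  Tendsto (fun r : ℕ => ((deg (iter f r) : ℕ) : ℝ) ^ (1 / (r : ℝ))) atTop (𝓝 l)

/-- `f_i` only involves the variables `x_1, …, x_i`. -/
def IsTriangular {k : Type*} [Field k] {n : ℕ} (f : AffEnd k n) : Prop :=
  ∀ i, f i ∈ supported k {j : Fin n | j ≤ i}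

def IsAffineAutomorphism {k : Type*} [Field k] {n : ℕ} (f : AffEnd k n) : Prop :=
  IsAutomorphism f ∧ deg f = 1

/-- `{f_1, …, f_n} = {x_1, …, x_n}`. -/
def IsCoordinatePermutation {k : Type*} [Field k] {n : ℕ} (f : AffEnd k n) : Prop :=
  Set.range f = Set.range (X : Fin n → MvPolynomial (Fin n) k)

def IsAffineTriangular {k : Type*} [Field k] {n : ℕ} (f : AffEnd k n) : Prop :=
  ∃ α τ : AffEnd k n, IsAffineAutomorphism α ∧ IsTriangular τ ∧ f = comp α τ

def IsPermutationTriangular {k : Type*} [Field k] {n : ℕ} (f : AffEnd k n) : Prop :=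
  ∃ α τ : AffEnd k n, IsCoordinatePermutation α ∧ IsTriangular τ ∧ f = comp α τ

/-- `f = (x_{n+1} + p(x_1, …, x_n), x_1, …, x_n)` for some polynomial `p`. -/
def IsShiftLike {k : Type*} [Field k] {n : ℕ} (f : AffEnd k (n + 1)) : Prop :=
  ∃ p : MvPolynomial (Fin n) k,
    f = Fin.cons (X (Fin.last n) + rename Fin.castSucc p) (fun i : Fin n => X i.castSucc)

/-- The endomorphism of the affine space of dimension `2n` whose `j`-th component is
`x_{n+j} + ∏ i, x_i ^ (A j i)` and whose `(n+j)`-th component is `x_j`, for `1 ≤ j ≤ n`. -/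
def ofMatrix (k : Type*) [Field k] {n : ℕ} (A : Matrix (Fin n) (Fin n) ℕ) : AffEnd k (n + n) :=
  Fin.append (fun j => X (Fin.natAdd n j) + ∏ i, X (Fin.castAdd n i) ^ A j i)
    (fun j => X (Fin.castAdd n j))

end

end AffEnd

/-- A weak Perron number: a real algebraic integer `l ≥ 1` all of whose Galois conjugates in `ℂ`
have absolute value at most `l`. -/
def IsWeakPerron (l : ℝ) : Prop :=
  1 ≤ l ∧ IsIntegral ℤ l ∧ ∀ μ : ℂ, Polynomial.aeval μ (minpoly ℚ l) = 0 → ‖μ‖ ≤ l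

/-!
Give the variables positive real weights `μ i`. If every `f i` has weighted degree at most
`θ * μ i`, then `deg (f^r)` is `O(θ ^ r)`; if moreover the iterates of the leading part of `f` do
not vanish, then `deg (f^r)` grows exactly like `θ ^ r`. For the two explicit automorphisms the
leading part consists of monomials and the weights come from an eigenvector: they are powers of
`l` for the shift-like one, and `(v, l⁻¹ v)` with `A v = l v` for the one attached to `A`.

For `b < 0`, the discriminant `a² + 4b = (2l - a)²` is a positive integer other than `1`, whence
`l > a - ⌊a/2⌋`, and `(l - ⌊a/2⌋) (l - (a - ⌊a/2⌋)) = ⌊a/2⌋ (a - ⌊a/2⌋) + b` is positive. So `A`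
is a positive matrix, with eigenvector `(1, l - ⌊a/2⌋)`.

An affine-triangular automorphism of the affine space of dimension `3` is linearly conjugate to
one whose `i`-th component is a non-zero multiple of the variable `π i` plus a polynomial in the
smaller variables, for a permutation `π`: this is Gaussian elimination on the components. Each of
the six permutations leads to a normal form whose dynamical degree is at most `1` or satisfies
`l² = a' l + b'` with `a', b' ≥ 0`; a quadratic irrational satisfies only one equation of this
shape, so `b < 0` is impossible.
-/

section Weights

variable {σ τ R M : Type*}

section Submodules

variable [CommSemiring R] [AddCommMonoid M]

/-- The polynomials all of whose monomials have weight at most `s`, where `X i` has weight `μ i`. -/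
noncomputable def weightLE [LE M] (R : Type*) [CommSemiring R] (μ : σ → M) (s : M) :
    Submodule R (MvPolynomial σ R) :=
  restrictSupport R {m | Finsupp.weight μ m ≤ s}

/-- The polynomials all of whose monomials have weight less than `s`, where `X i` has
weight `μ i`. -/
noncomputable def weightLT [LT M] (R : Type*) [CommSemiring R] (μ : σ → M) (s : M) :
    Submodule R (MvPolynomial σ R) :=
  restrictSupport R {m | Finsupp.weight μ m < s}

theorem mem_weightLE [LE M] {μ : σ → M} {s : M} {p : MvPolynomial σ R} :
    p ∈ weightLE R μ s ↔ ∀ m, coeff m p ≠ 0 → Finsupp.weight μ m ≤ s := by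
  simp [weightLE, mem_restrictSupport_iff, Set.subset_def]

theorem mem_weightLT [LT M] {μ : σ → M} {s : M} {p : MvPolynomial σ R} :
    p ∈ weightLT R μ s ↔ ∀ m, coeff m p ≠ 0 → Finsupp.weight μ m < s := by
  simp [weightLT, mem_restrictSupport_iff, Set.subset_def]

section Preorder

variable [Preorder M] {μ : σ → M} {s t : M} {p q : MvPolynomial σ R}

theorem weightLT_le_weightLE (s : M) : weightLT R μ s ≤ weightLE R μ s :=
  restrictSupport_mono _ fun _ hm => le_of_lt (Set.mem_ofPred.1 hm)

theorem weightLE_mono (h : s ≤ t) : weightLE R μ s ≤ weightLE R μ t :=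
  restrictSupport_mono _ fun _ hm => le_trans hm h

theorem weightLE_le_weightLT (h : s < t) : weightLE R μ s ≤ weightLT R μ t :=
  restrictSupport_mono _ fun _ hm => lt_of_le_of_lt hm h

theorem monomial_mem_weightLE {m : σ →₀ ℕ} (c : R) (h : Finsupp.weight μ m ≤ s) :
    monomial m c ∈ weightLE R μ s :=
  (monomial_mem_restrictSupport R).2 (Or.inl h)

theorem C_mem_weightLE (c : R) (h : 0 ≤ s) : (C c : MvPolynomial σ R) ∈ weightLE R μ s :=
  monomial_mem_weightLE c (by rwa [map_zero])

theorem X_mem_weightLE {i : σ} (h : μ i ≤ s) : (X i : MvPolynomial σ R) ∈ weightLE R μ s :=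
  monomial_mem_weightLE 1 (by rwa [Finsupp.weight_single, one_smul])

theorem smul_X_mem_weightLE (c : R) {i : σ} (h : μ i ≤ s) : c • X i ∈ weightLE R μ s :=
  Submodule.smul_mem _ c (X_mem_weightLE h)

end Preorder

variable [PartialOrder M] [IsOrderedCancelAddMonoid M] {μ : σ → M} {s t : M}
  {p q : MvPolynomial σ R}

theorem mul_mem_weightLE (hp : p ∈ weightLE R μ s) (hq : q ∈ weightLE R μ t) :
    p * q ∈ weightLE R μ (s + t) := by
  have hpq := Submodule.mul_mem_mul hp hq
  rw [weightLE, weightLE, ← restrictSupport_add] at hpq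
  refine restrictSupport_mono _ ?_ hpq
  rintro _ ⟨m, hm, m', hm', rfl⟩
  exact (map_add _ m m').trans_le (add_le_add hm hm')

theorem mul_mem_weightLT (hp : p ∈ weightLE R μ s) (hq : q ∈ weightLT R μ t) :
    p * q ∈ weightLT R μ (s + t) := by
  have hpq := Submodule.mul_mem_mul hp hq
  rw [weightLE, weightLT, ← restrictSupport_add] at hpq
  refine restrictSupport_mono _ ?_ hpq
  rintro _ ⟨m, hm, m', hm', rfl⟩
  exact (map_add _ m m').trans_lt (add_lt_add_of_le_of_lt hm hm')

theorem pow_mem_weightLE (hp : p ∈ weightLE R μ s) (a : ℕ) : p ^ a ∈ weightLE R μ (a • s) := by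
  induction a with
  | zero => rw [pow_zero, zero_smul]; exact C_mem_weightLE 1 le_rfl
  | succ a ih => rw [pow_succ, succ_nsmul]; exact mul_mem_weightLE ih hp

theorem prod_mem_weightLE {ι : Type*} {S : Finset ι} {u : ι → MvPolynomial σ R} {w : ι → M}
    (hu : ∀ i ∈ S, u i ∈ weightLE R μ (w i)) : ∏ i ∈ S, u i ∈ weightLE R μ (∑ i ∈ S, w i) := by
  classical
  induction S using Finset.induction_on with
  | empty => exact C_mem_weightLE 1 le_rfl
  | insert i S hi ih =>
    rw [Finset.prod_insert hi, Finset.sum_insert hi]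
    exact mul_mem_weightLE (hu i (S.mem_insert_self i))
      (ih fun j hj => hu j (Finset.mem_insert_of_mem hj))

variable {ν : τ → M} {f : MvPolynomial τ R} {u : τ → MvPolynomial σ R}

theorem aeval_eq_sum_smul (u : τ → MvPolynomial σ R) (f : MvPolynomial τ R) :
    aeval u f = ∑ m ∈ f.support, coeff m f • ∏ i ∈ m.support, u i ^ m i := by
  simp only [aeval_def, eval₂_eq, algebraMap_eq, smul_eq_C_mul]

theorem prod_pow_mem_weightLE (hu : ∀ i, u i ∈ weightLE R μ (ν i)) (m : τ →₀ ℕ) :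
    ∏ i ∈ m.support, u i ^ m i ∈ weightLE R μ (Finsupp.weight ν m) :=
  prod_mem_weightLE fun i _ => pow_mem_weightLE (hu i) (m i)

theorem aeval_mem_weightLE (hf : f ∈ weightLE R ν s) (hu : ∀ i, u i ∈ weightLE R μ (ν i)) :
    aeval u f ∈ weightLE R μ s := by
  rw [aeval_eq_sum_smul]
  exact sum_mem fun m hm => Submodule.smul_mem _ _ <|
    weightLE_mono (mem_weightLE.1 hf m (mem_support_iff.1 hm)) (prod_pow_mem_weightLE hu m)

theorem aeval_mem_weightLT (hf : f ∈ weightLT R ν s) (hu : ∀ i, u i ∈ weightLE R μ (ν i)) :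
    aeval u f ∈ weightLT R μ s := by
  rw [aeval_eq_sum_smul]
  exact sum_mem fun m hm => Submodule.smul_mem _ _ <|
    weightLE_le_weightLT (mem_weightLT.1 hf m (mem_support_iff.1 hm)) (prod_pow_mem_weightLE hu m)

end Submodules

section TotalDegree

variable [CommSemiring R] {p : MvPolynomial σ R}

theorem totalDegree_le_iff_mem_weightLE {d : ℕ} :
    p.totalDegree ≤ d ↔ p ∈ weightLE R (fun _ => (1 : ℕ)) d := by
  rw [mem_weightLE, totalDegree, Finset.sup_le_iff]
  simp only [Finsupp.weight_apply, smul_eq_mul, mul_one, mem_support_iff]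

theorem totalDegree_aeval_le {f : MvPolynomial τ R} {u : τ → MvPolynomial σ R} {d : ℕ}
    (hu : ∀ i, (u i).totalDegree ≤ d) : (aeval u f).totalDegree ≤ f.totalDegree * d := by
  rw [totalDegree_le_iff_mem_weightLE]
  refine aeval_mem_weightLE (ν := fun _ => d) (mem_weightLE.2 fun m hm => ?_) fun i =>
    totalDegree_le_iff_mem_weightLE.1 (hu i)
  calc Finsupp.weight (fun _ => d) m = m.sum (fun _ e => e) * d := by
        simp only [Finsupp.weight_apply, smul_eq_mul, Finsupp.sum, Finset.sum_mul]
    _ ≤ f.totalDegree * d := Nat.mul_le_mul_right d (le_totalDegree (mem_support_iff.2 hm))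

variable [AddCommMonoid M] [PartialOrder M] [IsOrderedAddMonoid M] {μ : σ → M} {s : M}

theorem degree_nsmul_le_weight (hμ : ∀ i, s ≤ μ i) (m : σ →₀ ℕ) :
    m.degree • s ≤ Finsupp.weight μ m := by
  rw [Finsupp.degree_apply, Finset.sum_smul]
  exact Finset.sum_le_sum fun i _ => nsmul_le_nsmul_right (hμ i) (m i)

theorem weight_le_degree_nsmul (hμ : ∀ i, μ i ≤ s) (m : σ →₀ ℕ) :
    Finsupp.weight μ m ≤ m.degree • s := by
  rw [Finsupp.degree_apply, Finset.sum_smul]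
  exact Finset.sum_le_sum fun i _ => nsmul_le_nsmul_right (hμ i) (m i)

theorem totalDegree_nsmul_le_of_mem_weightLE {δ : M} (hs : 0 ≤ s) (hμ : ∀ i, δ ≤ μ i)
    (hp : p ∈ weightLE R μ s) : p.totalDegree • δ ≤ s := by
  rcases eq_or_ne p 0 with rfl | hp0
  · rwa [totalDegree_zero, zero_nsmul]
  · obtain ⟨m, hm, hmp⟩ := p.support.exists_mem_eq_sup (support_nonempty.2 hp0)
      fun m => m.sum fun _ e => e
    rw [totalDegree, hmp]
    exact (degree_nsmul_le_weight hμ m).trans (mem_weightLE.1 hp m (mem_support_iff.1 hm))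

theorem weight_le_totalDegree_nsmul (hs : 0 ≤ s) (hμ : ∀ i, μ i ≤ s) {m : σ →₀ ℕ}
    (hm : coeff m p ≠ 0) : Finsupp.weight μ m ≤ p.totalDegree • s :=
  (weight_le_degree_nsmul hμ m).trans
    (nsmul_le_nsmul_left hs (le_totalDegree (mem_support_iff.2 hm)))

end TotalDegree

/-- `g` is the part of weight `s` of `p`, and `p` has no monomial of larger weight. The part `g`
may vanish. -/
def HasTop [CommRing R] [AddCommMonoid M] [LT M] (μ : σ → M) (s : M) (p g : MvPolynomial σ R) :
    Prop :=
  IsWeightedHomogeneous μ g s ∧ p - g ∈ weightLT R μ s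

namespace HasTop

variable [CommRing R] [AddCommMonoid M]

theorem of_isWeightedHomogeneous [LT M] {μ : σ → M} {s : M} {g : MvPolynomial σ R}
    (hg : IsWeightedHomogeneous μ g s) : HasTop μ s g g :=
  ⟨hg, by rw [sub_self]; exact zero_mem _⟩

theorem of_mem_weightLT [LT M] {μ : σ → M} {s : M} {p : MvPolynomial σ R}
    (hp : p ∈ weightLT R μ s) : HasTop μ s p 0 :=
  ⟨isWeightedHomogeneous_zero _ _ _, by rwa [sub_zero]⟩

variable [PartialOrder M] {μ : σ → M} {s t : M} {p q g h : MvPolynomial σ R}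

theorem X (i : σ) : HasTop μ (μ i) (X i : MvPolynomial σ R) (MvPolynomial.X i) :=
  of_isWeightedHomogeneous (isWeightedHomogeneous_X _ _ _)

theorem add (hp : HasTop μ s p g) (hq : HasTop μ s q h) : HasTop μ s (p + q) (g + h) :=
  ⟨hp.1.add hq.1, by rw [add_sub_add_comm]; exact add_mem hp.2 hq.2⟩

theorem add_right (hp : HasTop μ s p g) (hq : q ∈ weightLT R μ s) : HasTop μ s (p + q) g := by
  simpa only [add_zero] using hp.add (of_mem_weightLT hq)

theorem smul (c : R) (hp : HasTop μ s p g) : HasTop μ s (c • p) (c • g) :=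
  ⟨by rw [smul_eq_C_mul]; exact hp.1.C_mul c,
    by rw [← smul_sub]; exact Submodule.smul_mem _ _ hp.2⟩

theorem sum {ι : Type*} {S : Finset ι} {u v : ι → MvPolynomial σ R}
    (huv : ∀ i ∈ S, HasTop μ s (u i) (v i)) : HasTop μ s (∑ i ∈ S, u i) (∑ i ∈ S, v i) :=
  ⟨IsWeightedHomogeneous.sum S v s fun i hi => (huv i hi).1, by
    rw [← Finset.sum_sub_distrib]; exact sum_mem fun i hi => (huv i hi).2⟩

theorem of_mem_weightLE (hp : p ∈ weightLE R μ s) :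
    HasTop μ s p (weightedHomogeneousComponent μ s p) := by
  classical
  refine ⟨weightedHomogeneousComponent_isWeightedHomogeneous _ _, mem_weightLT.2 fun m hm => ?_⟩
  rw [coeff_sub, coeff_weightedHomogeneousComponent] at hm
  split_ifs at hm with hms
  · exact absurd (sub_self _) hm
  · rw [sub_zero] at hm
    exact lt_of_le_of_ne (mem_weightLE.1 hp m hm) hms

theorem mem_weightLE_of_isWeightedHomogeneous (hg : IsWeightedHomogeneous μ g s) :
    g ∈ weightLE R μ s :=
  mem_weightLE.2 fun _ hm => (hg hm).le

theorem mem_weightLE (hp : HasTop μ s p g) : p ∈ weightLE R μ s := by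
  simpa only [sub_add_cancel] using
    add_mem (weightLT_le_weightLE s hp.2) (mem_weightLE_of_isWeightedHomogeneous hp.1)

theorem coeff_eq (hp : HasTop μ s p g) {m : σ →₀ ℕ} (hm : Finsupp.weight μ m = s) :
    coeff m p = coeff m g := by
  by_contra hne
  have hne' : coeff m (p - g) ≠ 0 := by rwa [coeff_sub, sub_ne_zero]
  exact (mem_weightLT.1 hp.2 m hne').ne hm

theorem weightedHomogeneousComponent_eq (hp : HasTop μ s p g) :
    weightedHomogeneousComponent μ s p = g := by
  classical
  ext m
  rw [coeff_weightedHomogeneousComponent]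
  split_ifs with hm
  · exact hp.coeff_eq hm
  · exact (hp.1.coeff_eq_zero m hm).symm

variable [IsOrderedCancelAddMonoid M]

theorem mul (hp : HasTop μ s p g) (hq : HasTop μ t q h) : HasTop μ (s + t) (p * q) (g * h) := by
  refine ⟨hp.1.mul hq.1, ?_⟩
  have hsplit : p * q - g * h = p * (q - h) + h * (p - g) := by ring
  rw [hsplit]
  refine add_mem (mul_mem_weightLT hp.mem_weightLE hq.2) ?_
  rw [add_comm s t]
  exact mul_mem_weightLT (mem_weightLE_of_isWeightedHomogeneous hq.1) hp.2

theorem pow (hp : HasTop μ s p g) (a : ℕ) : HasTop μ (a • s) (p ^ a) (g ^ a) := by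
  induction a with
  | zero =>
    simpa only [pow_zero, zero_smul] using
      of_isWeightedHomogeneous (isWeightedHomogeneous_one R μ)
  | succ a ih => simpa only [pow_succ, succ_nsmul] using ih.mul hp

theorem prod {ι : Type*} {S : Finset ι} {u v : ι → MvPolynomial σ R} {w : ι → M}
    (huv : ∀ i ∈ S, HasTop μ (w i) (u i) (v i)) :
    HasTop μ (∑ i ∈ S, w i) (∏ i ∈ S, u i) (∏ i ∈ S, v i) := by
  classical
  induction S using Finset.induction_on with
  | empty => exact of_isWeightedHomogeneous (isWeightedHomogeneous_one _ _)
  | insert i S hi ih =>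
    rw [Finset.sum_insert hi, Finset.prod_insert hi, Finset.prod_insert hi]
    exact (huv i (S.mem_insert_self i)).mul (ih fun j hj => huv j (Finset.mem_insert_of_mem hj))

theorem aeval {ν : τ → M} {f F : MvPolynomial τ R} (hf : HasTop ν s f F)
    {u v : τ → MvPolynomial σ R} (huv : ∀ i, HasTop μ (ν i) (u i) (v i)) :
    HasTop μ s (aeval u f) (aeval v F) := by
  have hF : HasTop μ s (MvPolynomial.aeval u F) (MvPolynomial.aeval v F) := by
    rw [aeval_eq_sum_smul, aeval_eq_sum_smul]
    refine sum fun m hm => smul _ ?_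
    rw [← hf.1 (mem_support_iff.1 hm)]
    exact prod fun i _ => (huv i).pow (m i)
  simpa only [← map_add, add_sub_cancel] using
    hF.add_right (aeval_mem_weightLT hf.2 fun i => (huv i).mem_weightLE)

end HasTop

section Scaling

variable {K : Type*} [Semiring K]

theorem weight_const_mul (ρ : K) (μ : σ → K) (m : σ →₀ ℕ) :
    Finsupp.weight (fun i => ρ * μ i) m = ρ * Finsupp.weight μ m := by
  simp only [Finsupp.weight_apply, Finsupp.sum, Finset.mul_sum, mul_smul_comm]

variable [PartialOrder K] [IsStrictOrderedRing K] {μ : σ → K} {s ρ : K}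

theorem mem_weightLE_const_mul [CommSemiring R] {p : MvPolynomial σ R} (hρ : 0 ≤ ρ)
    (hp : p ∈ weightLE R μ s) : p ∈ weightLE R (fun i => ρ * μ i) (ρ * s) :=
  mem_weightLE.2 fun m hm => (weight_const_mul ρ μ m).trans_le
    (mul_le_mul_of_nonneg_left (mem_weightLE.1 hp m hm) hρ)

theorem HasTop.const_mul [CommRing R] {p g : MvPolynomial σ R} (hρ : 0 < ρ)
    (hp : HasTop μ s p g) : HasTop (fun i => ρ * μ i) (ρ * s) p g :=
  ⟨fun m hm => by rw [weight_const_mul, hp.1 hm],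
    mem_weightLT.2 fun m hm => (weight_const_mul ρ μ m).trans_lt
      (mul_lt_mul_of_pos_left (mem_weightLT.1 hp.2 m hm) hρ)⟩

end Scaling

end Weights

namespace AffEnd

variable {k : Type*} [Field k] {n : ℕ}

section Composition

theorem aeval_aeval (g h : AffEnd k n) (p : MvPolynomial (Fin n) k) :
    aeval h (aeval g p) = aeval (comp g h) p := by
  rw [comp_aeval_apply]
  rfl

theorem comp_assoc (f g h : AffEnd k n) : comp (comp f g) h = comp f (comp g h) := by
  funext i
  rw [comp, comp, comp, aeval_aeval]

theorem comp_one (f : AffEnd k n) : comp f (one k n) = f := by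
  funext i
  rw [comp, show one k n = X from rfl, aeval_X_left_apply]

theorem one_comp (f : AffEnd k n) : comp (one k n) f = f := by
  funext i
  rw [comp, one, aeval_X]

theorem iter_succ' (f : AffEnd k n) (r : ℕ) : iter f (r + 1) = comp (iter f r) f := by
  induction r with
  | zero => exact (comp_one f).trans (one_comp f).symm
  | succ r ih => rw [iter, ih, ← comp_assoc, ← iter, ih]

theorem iter_conj {β β' : AffEnd k n} (h : comp β β' = one k n) (h' : comp β' β = one k n)
    (f : AffEnd k n) (r : ℕ) :
    iter (comp (comp β f) β') r = comp (comp β (iter f r)) β' := by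
  induction r with
  | zero => rw [iter, iter, comp_one, h]
  | succ r ih =>
    rw [iter, ih, iter, comp_assoc, comp_assoc β (iter f r), ← comp_assoc β' β, h', one_comp,
      comp_assoc, comp_assoc, comp_assoc]

theorem totalDegree_le_deg (f : AffEnd k n) (i : Fin n) : (f i).totalDegree ≤ deg f :=
  Finset.le_sup (f := fun i => (f i).totalDegree) (Finset.mem_univ i)

theorem deg_comp_le (f g : AffEnd k n) : deg (comp f g) ≤ deg f * deg g :=
  Finset.sup_le fun i _ => (totalDegree_aeval_le (totalDegree_le_deg g)).trans
    (Nat.mul_le_mul_right _ (totalDegree_le_deg f i))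

theorem deg_comp_comp_le (f g h : AffEnd k n) :
    deg (comp (comp f g) h) ≤ deg f * deg h * deg g :=
  calc deg (comp (comp f g) h) ≤ deg (comp f g) * deg h := deg_comp_le _ _
    _ ≤ deg f * deg g * deg h := Nat.mul_le_mul_right _ (deg_comp_le f g)
    _ = deg f * deg h * deg g := mul_right_comm _ _ _

end Composition

section Growth

theorem tendsto_const_mul_rpow_one_div {u : ℕ → ℝ} {c l : ℝ} (hc : 0 < c) (hu : ∀ r, 0 ≤ u r)
    (h : Tendsto (fun r : ℕ => u r ^ (1 / (r : ℝ))) atTop (𝓝 l)) :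
    Tendsto (fun r : ℕ => (c * u r) ^ (1 / (r : ℝ))) atTop (𝓝 l) := by
  have hone : Tendsto (fun r : ℕ => c ^ (1 / (r : ℝ))) atTop (𝓝 1) := by
    simpa only [Real.rpow_zero] using
      tendsto_const_nhds.rpow (tendsto_const_div_atTop_nhds_zero_nat (1 : ℝ)) (Or.inl hc.ne')
  simpa only [one_mul, Real.mul_rpow hc.le (hu _)] using hone.mul h

theorem tendsto_const_mul_pow_rpow_one_div {c θ : ℝ} (hc : 0 < c) (hθ : 0 ≤ θ) :
    Tendsto (fun r : ℕ => (c * θ ^ r) ^ (1 / (r : ℝ))) atTop (𝓝 θ) := by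
  refine tendsto_const_mul_rpow_one_div hc (fun r => pow_nonneg hθ r)
    (tendsto_const_nhds.congr' ?_)
  filter_upwards [eventually_gt_atTop 0] with r hr
  rw [one_div, Real.pow_rpow_inv_natCast hθ hr.ne']

variable {f g : AffEnd k n} {l θ c c' : ℝ}

theorem IsDynamicalDegree.le (hf : IsDynamicalDegree f l) (hc : 0 < c) (hθ : 0 ≤ θ)
    (h : ∀ r, (deg (iter f r) : ℝ) ≤ c * θ ^ r) : l ≤ θ :=
  le_of_tendsto_of_tendsto' hf (tendsto_const_mul_pow_rpow_one_div hc hθ) fun r =>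
    Real.rpow_le_rpow (Nat.cast_nonneg _) (h r) (by positivity)

theorem IsDynamicalDegree.ge (hf : IsDynamicalDegree f l) (hc : 0 < c) (hθ : 0 ≤ θ)
    (h : ∀ r, c * θ ^ r ≤ (deg (iter f r) : ℝ)) : θ ≤ l :=
  le_of_tendsto_of_tendsto' (tendsto_const_mul_pow_rpow_one_div hc hθ) hf fun r =>
    Real.rpow_le_rpow (by positivity) (h r) (by positivity)

theorem isDynamicalDegree_of_bounds (hθ : 0 ≤ θ) (hc : 0 < c) (hc' : 0 < c')
    (h : ∀ r, c * θ ^ r ≤ (deg (iter f r) : ℝ)) (h' : ∀ r, (deg (iter f r) : ℝ) ≤ c' * θ ^ r) :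
    IsDynamicalDegree f θ :=
  tendsto_of_tendsto_of_tendsto_of_le_of_le (tendsto_const_mul_pow_rpow_one_div hc hθ)
    (tendsto_const_mul_pow_rpow_one_div hc' hθ)
    (fun r => Real.rpow_le_rpow (by positivity) (h r) (by positivity))
    (fun r => Real.rpow_le_rpow (Nat.cast_nonneg _) (h' r) (by positivity))

theorem IsDynamicalDegree.of_deg_iter_le_mul (hf : IsDynamicalDegree f l) (hc : 0 < c)
    (h : ∀ r, (deg (iter g r) : ℝ) ≤ c * deg (iter f r))
    (h' : ∀ r, (deg (iter f r) : ℝ) ≤ c * deg (iter g r)) : IsDynamicalDegree g l :=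
  have hdeg (r : ℕ) : (0 : ℝ) ≤ deg (iter f r) := Nat.cast_nonneg _
  tendsto_of_tendsto_of_tendsto_of_le_of_le
    (tendsto_const_mul_rpow_one_div (inv_pos.2 hc) hdeg hf)
    (tendsto_const_mul_rpow_one_div hc hdeg hf)
    (fun r => Real.rpow_le_rpow (by positivity) ((inv_mul_le_iff₀ hc).2 (h' r)) (by positivity))
    (fun r => Real.rpow_le_rpow (Nat.cast_nonneg _) (h r) (by positivity))

theorem IsDynamicalDegree.conj (hf : IsDynamicalDegree f l) {β β' : AffEnd k n}
    (h : comp β β' = one k n) (h' : comp β' β = one k n) :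
    IsDynamicalDegree (comp (comp β f) β') l := by
  have hinv (g : AffEnd k n) : comp (comp β' (comp (comp β g) β')) β = g := by
    rw [← comp_assoc, ← comp_assoc, h', one_comp, comp_assoc, h', comp_one]
  have hle (d e : ℕ) (hde : d ≤ deg β * deg β' * e) :
      (d : ℝ) ≤ ((deg β * deg β' + 1 : ℕ) : ℝ) * e := by
    exact_mod_cast hde.trans (Nat.mul_le_mul_right e (Nat.le_succ _))
  refine hf.of_deg_iter_le_mul (Nat.cast_pos.2 (Nat.succ_pos _)) (fun r => hle _ _ ?_)
    fun r => hle _ _ ?_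
  · rw [iter_conj h h']
    exact deg_comp_comp_le _ _ _
  · rw [iter_conj h h', mul_comm (deg β)]
    conv_lhs => rw [← hinv (iter f r)]
    exact deg_comp_comp_le _ _ _

end Growth

section WeightBounds

variable {μ : Fin n → ℝ} {θ l : ℝ} {f g : AffEnd k n}

theorem iter_mem_weightLE (hθ : 0 ≤ θ) (hf : ∀ i, f i ∈ weightLE k μ (θ * μ i)) (r : ℕ)
    (i : Fin n) : iter f r i ∈ weightLE k μ (θ ^ r * μ i) := by
  induction r generalizing i with
  | zero => exact X_mem_weightLE (by rw [pow_zero, one_mul])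
  | succ r ih =>
    rw [pow_succ, mul_assoc]
    exact aeval_mem_weightLE (mem_weightLE_const_mul (pow_nonneg hθ r) (hf i)) ih

theorem iter_hasTop (hθ : 0 < θ) (hf : ∀ i, HasTop μ (θ * μ i) (f i) (g i)) (r : ℕ) (i : Fin n) :
    HasTop μ (θ ^ r * μ i) (iter f r i) (iter g r i) := by
  induction r generalizing i with
  | zero => rw [pow_zero, one_mul]; exact HasTop.X i
  | succ r ih =>
    rw [pow_succ, mul_assoc]
    exact ((hf i).const_mul (pow_pos hθ r)).aeval ih

theorem cast_deg_le {c : ℝ} (hc : 0 ≤ c) (hf : ∀ i, ((f i).totalDegree : ℝ) ≤ c) :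
    (deg f : ℝ) ≤ c :=
  (Nat.cast_le.2 (Finset.sup_le fun i _ => Nat.le_floor (hf i))).trans (Nat.floor_le hc)

theorem exists_deg_iter_le (hθ : 0 ≤ θ) (hμ : ∀ i, 0 < μ i)
    (hf : ∀ i, f i ∈ weightLE k μ (θ * μ i)) :
    ∃ c > 0, ∀ r, (deg (iter f r) : ℝ) ≤ c * θ ^ r := by
  obtain ⟨⟨δ, hδ⟩, hδμ⟩ := Finite.exists_ge fun i => (⟨μ i, hμ i⟩ : Set.Ioi (0 : ℝ))
  obtain ⟨⟨B, hB⟩, hμB⟩ := Finite.exists_le fun i => (⟨μ i, hμ i⟩ : Set.Ioi (0 : ℝ))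
  rw [Set.mem_Ioi] at hδ hB
  refine ⟨B / δ, div_pos hB hδ, fun r => cast_deg_le (by positivity) fun i => ?_⟩
  rw [div_mul_eq_mul_div, le_div_iff₀ hδ, ← nsmul_eq_mul]
  calc (iter f r i).totalDegree • δ ≤ θ ^ r * μ i :=
        totalDegree_nsmul_le_of_mem_weightLE (mul_nonneg (pow_nonneg hθ r) (hμ i).le) hδμ
          (iter_mem_weightLE hθ hf r i)
    _ ≤ θ ^ r * B := mul_le_mul_of_nonneg_left (hμB i) (pow_nonneg hθ r)
    _ = B * θ ^ r := mul_comm _ _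

theorem exists_le_deg_iter (hθ : 0 < θ) (hf : ∀ i, HasTop μ (θ * μ i) (f i) (g i)) {i : Fin n}
    (hi : 0 < μ i) (hg : ∀ r, iter g r i ≠ 0) :
    ∃ c > 0, ∀ r, c * θ ^ r ≤ (deg (iter f r) : ℝ) := by
  obtain ⟨B, hμB⟩ := Finite.exists_le μ
  have hB : 0 < B := hi.trans_le (hμB i)
  refine ⟨μ i / B, div_pos hi hB, fun r => ?_⟩
  obtain ⟨m, hm⟩ := ne_zero_iff.1 (hg r)
  have htop := iter_hasTop hθ hf r i
  have hw : Finsupp.weight μ m = θ ^ r * μ i := htop.1 hm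
  rw [← htop.coeff_eq hw] at hm
  rw [div_mul_eq_mul_div, div_le_iff₀ hB, mul_comm (μ i), ← hw, ← nsmul_eq_mul]
  exact (weight_le_totalDegree_nsmul hB.le hμB hm).trans
    (nsmul_le_nsmul_left hB.le (totalDegree_le_deg _ i))

theorem IsDynamicalDegree.le_of_weight (hl : IsDynamicalDegree f l) (hθ : 0 ≤ θ)
    (hμ : ∀ i, 0 < μ i) (hf : ∀ i, f i ∈ weightLE k μ (θ * μ i)) : l ≤ θ :=
  let ⟨_, hc, h⟩ := exists_deg_iter_le hθ hμ hf
  hl.le hc hθ h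

/-- The components of weight `θ * μ i` of the polynomials `f i`. If no `f i` has a monomial of
larger weight, and some component of the iterates of `leadingPart μ θ f` does not vanish, then the
degrees of the iterates of `f` grow like `θ ^ r`. -/
noncomputable def leadingPart (μ : Fin n → ℝ) (θ : ℝ) (f : AffEnd k n) : AffEnd k n :=
  fun i => weightedHomogeneousComponent μ (θ * μ i) (f i)

theorem leadingPart_eq_of_eq_smul_X_add {i j : Fin n} {c : k} {p : MvPolynomial (Fin n) k}
    (hf : f i = c • X j + p) (h : μ j ≠ θ * μ i) :
    leadingPart μ θ f i = weightedHomogeneousComponent μ (θ * μ i) p := by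
  rw [leadingPart, hf, map_add, map_smul,
    (isWeightedHomogeneous_X k μ j).weightedHomogeneousComponent_ne _ h.symm, smul_zero, zero_add]

theorem IsDynamicalDegree.ge_of_weight (hl : IsDynamicalDegree f l) (hθ : 0 < θ)
    (hf : ∀ i, f i ∈ weightLE k μ (θ * μ i)) {i : Fin n} (hi : 0 < μ i)
    (hne : ∀ r, iter (leadingPart μ θ f) r i ≠ 0) : θ ≤ l :=
  let ⟨_, hc, h⟩ := exists_le_deg_iter hθ (fun i => HasTop.of_mem_weightLE (hf i)) hi hne
  hl.ge hc hθ.le h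

theorem iter_ne_zero_of_monomial (hg : ∀ i, ∃ m, ∃ c ≠ 0, g i = monomial m c) (r : ℕ)
    (i : Fin n) : iter g r i ≠ 0 := by
  induction r generalizing i with
  | zero => exact X_ne_zero i
  | succ r ih =>
    obtain ⟨m, c, hc, hm⟩ := hg i
    rw [iter, comp, hm, aeval_monomial, algebraMap_eq]
    exact mul_ne_zero (C_ne_zero.2 hc) (Finset.prod_ne_zero_iff.2 fun j _ => pow_ne_zero _ (ih j))

theorem isDynamicalDegree_of_hasTop_monomial [NeZero n] (hθ : 0 < θ) (hμ : ∀ i, 0 < μ i)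
    (hf : ∀ i, ∃ m, ∃ c ≠ 0, HasTop μ (θ * μ i) (f i) (monomial m c)) :
    IsDynamicalDegree f θ := by
  choose m c hc htop using hf
  have hne := iter_ne_zero_of_monomial fun i => ⟨m i, c i, hc i, rfl⟩
  obtain ⟨C, hC, h⟩ := exists_le_deg_iter hθ htop (hμ 0) fun r => hne r 0
  obtain ⟨C', hC', h'⟩ := exists_deg_iter_le hθ.le hμ fun i => (htop i).mem_weightLE
  exact isDynamicalDegree_of_bounds hθ.le hC hC' h h'

end WeightBounds

end AffEnd

section PolyIn

variable {R : Type*} [CommRing R] {σ : Type*}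

theorem aeval_mem_of_mem_supported {A : Type*} [CommRing A] [Algebra R A] {s : Set σ}
    {p : MvPolynomial σ R} (hp : p ∈ supported R s) {u : σ → A} {S : Subalgebra R A}
    (h : ∀ i ∈ s, u i ∈ S) : aeval u p ∈ S := by
  have hle : supported R s ≤ S.comap (aeval u) := by
    refine Algebra.adjoin_le ?_
    rintro _ ⟨i, hi, rfl⟩
    rw [SetLike.mem_coe, Subalgebra.mem_comap, aeval_X]
    exact h i hi
  exact hle hp

theorem natDegree_eq_one_and_isUnit_leadingCoeff [IsDomain R] {G P : Polynomial R}
    (h : G.comp P = Polynomial.X) : P.natDegree = 1 ∧ IsUnit P.leadingCoeff := by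
  have hdeg : G.natDegree = 1 ∧ P.natDegree = 1 := by
    rw [← mul_eq_one, ← Polynomial.natDegree_comp, h, Polynomial.natDegree_X]
  have hlead : G.leadingCoeff * P.leadingCoeff = 1 := by
    have hcomp := Polynomial.leadingCoeff_comp (p := G) (q := P) (by lia)
    rwa [h, Polynomial.leadingCoeff_X, hdeg.1, pow_one, eq_comm] at hcomp
  exact ⟨hdeg.2, IsUnit.of_mul_eq_one_right _ hlead⟩

variable {t : σ}

section DecidableEq

variable [DecidableEq σ]

/-- The polynomial `p` regarded as a univariate polynomial in the variable `t`, whose coefficients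
are polynomials in the other variables. The coefficient ring is still written as the ring of
polynomials in all the variables. -/
noncomputable def polyIn (R : Type*) [CommRing R] (t : σ) :
    MvPolynomial σ R →ₐ[R] Polynomial (MvPolynomial σ R) :=
  aeval (Function.update (fun i => Polynomial.C (X i)) t Polynomial.X)

theorem polyIn_X_self : polyIn R t (X t) = Polynomial.X := by
  rw [polyIn, aeval_X, Function.update_self]

theorem polyIn_X_of_ne {i : σ} (hi : i ≠ t) : polyIn R t (X i) = Polynomial.C (X i) := by
  rw [polyIn, aeval_X, Function.update_of_ne hi]

theorem eval_polyIn (z p : MvPolynomial σ R) :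
    (polyIn R t p).eval z = aeval (Function.update X t z) p := by
  have h : ((Polynomial.aeval z).restrictScalars R).comp (polyIn R t) =
      aeval (Function.update X t z) := by
    ext1 i
    by_cases hi : i = t
    · subst hi
      simp [polyIn_X_self]
    · simp [polyIn_X_of_ne hi, hi]
  exact DFunLike.congr_fun h p

theorem eval_X_polyIn (p : MvPolynomial σ R) : (polyIn R t p).eval (X t) = p := by
  rw [eval_polyIn, Function.update_eq_self, aeval_X_left_apply]

theorem coeff_zero_polyIn_mem_supported {s : Set σ} {p : MvPolynomial σ R}
    (hp : p ∈ supported R s) : (polyIn R t p).coeff 0 ∈ supported R (s \ {t}) := by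
  rw [Polynomial.coeff_zero_eq_eval_zero, eval_polyIn]
  refine aeval_mem_of_mem_supported hp fun i hi => ?_
  by_cases hit : i = t
  · rw [hit, Function.update_self]
    exact zero_mem _
  · rw [Function.update_of_ne hit]
    exact Algebra.subset_adjoin ⟨i, ⟨hi, hit⟩, rfl⟩

theorem polyIn_of_mem_supported_compl {p : MvPolynomial σ R} (hp : p ∈ supported R {t}ᶜ) :
    polyIn R t p = Polynomial.C p := by
  let φ : MvPolynomial σ R →ₐ[R] Polynomial (MvPolynomial σ R) :=
    (Algebra.ofId _ _).restrictScalars R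
  have h : Set.EqOn (polyIn R t) φ (X '' {t}ᶜ) := by
    rintro _ ⟨i, hi, rfl⟩
    exact polyIn_X_of_ne hi
  exact (AlgHom.eqOn_adjoin_iff (φ := polyIn R t) (ψ := φ)).2 h hp

theorem natDegree_polyIn_eq_zero_iff {p : MvPolynomial σ R} :
    (polyIn R t p).natDegree = 0 ↔ p ∈ supported R {t}ᶜ := by
  refine ⟨fun h => ?_, fun h => by rw [polyIn_of_mem_supported_compl h, Polynomial.natDegree_C]⟩
  have hp : p = (polyIn R t p).coeff 0 := by
    rw [← Polynomial.eval_C (a := (polyIn R t p).coeff 0) (x := X t),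
      ← Polynomial.eq_C_of_natDegree_eq_zero h, eval_X_polyIn]
  have huniv : p ∈ supported R Set.univ := mem_supported.2 (Set.subset_univ _)
  rw [hp]
  exact supported_mono (fun i hi => hi.2) (coeff_zero_polyIn_mem_supported huniv)

theorem polyIn_aeval {S : Subalgebra R (MvPolynomial σ R)} (hS : S ≤ supported R {t}ᶜ)
    (q : MvPolynomial σ R) (G : Polynomial S) :
    polyIn R t (Polynomial.aeval q G) = (G.map (algebraMap S _)).comp (polyIn R t q) := by
  induction G using Polynomial.induction_on' with
  | add G H hG hH => rw [map_add, map_add, hG, hH, Polynomial.map_add, Polynomial.add_comp]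
  | monomial d c =>
    rw [Polynomial.aeval_monomial, map_mul, map_pow, Polynomial.map_monomial,
      Polynomial.monomial_comp, show algebraMap S _ c = (c : MvPolynomial σ R) from rfl,
      polyIn_of_mem_supported_compl (hS c.2)]

end DecidableEq

theorem transcendental_of_notMem_supported [IsDomain R] {S : Subalgebra R (MvPolynomial σ R)}
    (hS : S ≤ supported R {t}ᶜ) {q : MvPolynomial σ R} (hq : q ∉ supported R {t}ᶜ) :
    Transcendental S q := by
  classical
  refine transcendental_iff.2 fun G hG => ?_
  have hcomp := polyIn_aeval hS q G
  rw [hG, map_zero, eq_comm, Polynomial.comp_eq_zero_iff] at hcomp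
  refine (Polynomial.map_eq_zero_iff (FaithfulSMul.algebraMap_injective S _)).1
    (hcomp.resolve_right fun h => hq ?_)
  rw [← natDegree_polyIn_eq_zero_iff, h.2, Polynomial.natDegree_C]

theorem mem_of_mem_adjoin_singleton [IsDomain R] {S : Subalgebra R (MvPolynomial σ R)}
    (hS : S ≤ supported R {t}ᶜ) {p q : MvPolynomial σ R} (hq : q ∉ supported R {t}ᶜ)
    (hp : p ∈ supported R {t}ᶜ) (hpq : p ∈ Algebra.adjoin S {q}) : p ∈ S := by
  classical
  rw [Algebra.adjoin_singleton_eq_range_aeval] at hpq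
  obtain ⟨G, hG⟩ := hpq
  have hcomp := polyIn_aeval hS q G
  rw [show Polynomial.aeval q G = p from hG] at hcomp
  have hdeg : (G.map (algebraMap S (MvPolynomial σ R))).natDegree = 0 := by
    have hmul := congrArg Polynomial.natDegree hcomp
    rw [natDegree_polyIn_eq_zero_iff.2 hp, Polynomial.natDegree_comp, eq_comm, mul_eq_zero] at hmul
    exact hmul.resolve_right (mt natDegree_polyIn_eq_zero_iff.1 hq)
  rw [polyIn_of_mem_supported_compl hp, Polynomial.eq_C_of_natDegree_eq_zero hdeg,
    Polynomial.C_comp, Polynomial.coeff_map] at hcomp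
  rw [Polynomial.C_injective hcomp]
  exact (G.coeff 0).2

end PolyIn

section Level

variable {k : Type*} [Field k] {σ : Type*} [LinearOrder σ] {m : σ}

/-- The polynomials that are the sum of a non-zero multiple of the variable `m` and of a polynomial
in the smaller variables, as are the components of a triangular automorphism. -/
def HasLevel (m : σ) (p : MvPolynomial σ k) : Prop :=
  ∃ c : k, c ≠ 0 ∧ ∃ q ∈ supported k (Set.Iio m), p = c • X m + q

theorem supported_Iio_le_compl : supported k (Set.Iio m) ≤ supported k {m}ᶜ :=
  supported_mono fun _ hj => ne_of_lt hj

namespace HasLevel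

variable {p : MvPolynomial σ k}

theorem smul_add (hp : HasLevel m p) {c : k} (hc : c ≠ 0) {q : MvPolynomial σ k}
    (hq : q ∈ supported k (Set.Iio m)) : HasLevel m (c • p + q) := by
  obtain ⟨d, hd, r, hr, rfl⟩ := hp
  refine ⟨c * d, mul_ne_zero hc hd, c • r + q, add_mem (Subalgebra.smul_mem _ hr c) hq, ?_⟩
  rw [_root_.smul_add, smul_smul, add_assoc]

theorem mem_supported (hp : HasLevel m p) : p ∈ supported k (Set.Iic m) := by
  obtain ⟨d, -, r, hr, rfl⟩ := hp
  exact add_mem (Subalgebra.smul_mem _ (X_mem_supported.2 Set.self_mem_Iic) d)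
    (supported_mono Set.Iio_subset_Iic_self hr)

theorem notMem_supported (hp : HasLevel m p) : p ∉ supported k {m}ᶜ := by
  obtain ⟨d, hd, r, hr, rfl⟩ := hp
  intro hmem
  rw [add_mem_cancel_right (supported_Iio_le_compl hr)] at hmem
  have hX := Subalgebra.smul_mem _ hmem d⁻¹
  rw [inv_smul_smul₀ hd, X_mem_supported] at hX
  exact hX rfl

theorem lt_of_mem (hp : HasLevel m p) {m' : σ} (h : p ∈ supported k (Set.Iio m')) : m < m' := by
  by_contra hlt
  refine hp.notMem_supported (supported_mono (fun j hj => ?_) h)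
  exact ne_of_lt (lt_of_lt_of_le hj (not_lt.1 hlt))

theorem exists_sub_smul_mem_supported (hp : HasLevel m p) {q : MvPolynomial σ k}
    (hq : HasLevel m q) : ∃ c : k, p - c • q ∈ supported k (Set.Iio m) := by
  obtain ⟨d, -, r, hr, rfl⟩ := hp
  obtain ⟨e, he, r', hr', rfl⟩ := hq
  refine ⟨d / e, ?_⟩
  rw [_root_.smul_add, smul_smul, div_mul_cancel₀ d he, add_sub_add_left_eq_sub]
  exact sub_mem hr (Subalgebra.smul_mem _ hr' _)

theorem aeval (hp : HasLevel m p) {u : σ → MvPolynomial σ k} (hu : ∀ j, HasLevel j (u j)) :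
    HasLevel m (aeval u p) := by
  obtain ⟨d, hd, r, hr, rfl⟩ := hp
  rw [map_add, map_smul, aeval_X]
  exact (hu m).smul_add hd (aeval_mem_of_mem_supported hr fun j hj =>
    supported_mono (Set.Iic_subset_Iio.2 hj) (hu j).mem_supported)

theorem of_X_mem_adjoin_singleton {S : Subalgebra k (MvPolynomial σ k)}
    (hS : S ≤ supported k {m}ᶜ) (hp : p ∈ supported k (Set.Iic m))
    (h : X m ∈ Algebra.adjoin S {p}) : HasLevel m p := by
  rw [Algebra.adjoin_singleton_eq_range_aeval] at h
  obtain ⟨G, hG⟩ := h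
  have hcomp := polyIn_aeval hS p G
  rw [show Polynomial.aeval p G = X m from hG, polyIn_X_self] at hcomp
  obtain ⟨hdeg, hunit⟩ := natDegree_eq_one_and_isUnit_leadingCoeff hcomp.symm
  obtain ⟨c, hc, hlead⟩ := isUnit_iff_eq_C_of_isReduced.1 hunit
  refine ⟨c, hc.ne_zero, (polyIn k m p).coeff 0, ?_, ?_⟩
  · exact supported_mono (fun i hi => lt_of_le_of_ne hi.1 hi.2) (coeff_zero_polyIn_mem_supported hp)
  · have hlin := Polynomial.eq_X_add_C_of_natDegree_le_one hdeg.le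
    rw [← hdeg, Polynomial.coeff_natDegree, hlead] at hlin
    have heval := congrArg (Polynomial.eval (X m)) hlin
    rwa [eval_X_polyIn, Polynomial.eval_add, Polynomial.eval_C_mul, Polynomial.eval_X,
      Polynomial.eval_C, C_mul'] at heval

end HasLevel

theorem exists_hasLevel_linearCombination [Fintype σ] {τ : σ → MvPolynomial σ k}
    (hτ : ∀ i, HasLevel i (τ i)) {a : σ → k} (ha : a ≠ 0) (c : k) :
    ∃ m, HasLevel m (C c + ∑ j, a j • τ j) := by
  have hne : {j | a j ≠ 0}.Nonempty := Function.ne_iff.1 ha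
  obtain ⟨m, hm, hmax⟩ := Set.exists_max_image {j | a j ≠ 0} id (Set.toFinite _) hne
  refine ⟨m, ?_⟩
  rw [← Finset.add_sum_erase _ _ (Finset.mem_univ m), add_left_comm]
  refine (hτ m).smul_add hm (add_mem (Subalgebra.algebraMap_mem _ c) (sum_mem fun j hj => ?_))
  by_cases haj : a j = 0
  · rw [haj, zero_smul]
    exact zero_mem _
  · have hjm : j < m := lt_of_le_of_ne (hmax j haj) (Finset.ne_of_mem_erase hj)
    exact Subalgebra.smul_mem _ (supported_mono (Set.Iic_subset_Iio.2 hjm) (hτ j).mem_supported) _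

end Level

section AffineTriangular

theorem exists_eq_C_add_sum_smul_X_of_totalDegree_le_one {R σ : Type*} [CommRing R] [Fintype σ]
    {p : MvPolynomial σ R} (hp : p.totalDegree ≤ 1) :
    ∃ (c : R) (a : σ → R), p = C c + ∑ j, a j • X j := by
  have hlin : homogeneousComponent 1 p ∈ Submodule.span R (Set.range X) := by
    rw [← homogeneousSubmodule_one_eq_span_X]
    exact homogeneousComponent_mem 1 p
  obtain ⟨a, ha⟩ := (Submodule.mem_span_range_iff_exists_fun R).1 hlin
  refine ⟨coeff 0 p, a, ?_⟩
  rw [ha, ← homogeneousComponent_zero, ← Finset.sum_range_one (fun i => homogeneousComponent i p),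
    ← Finset.sum_range_succ]
  obtain hp | hp := hp.lt_or_eq
  · rw [Finset.sum_range_succ, homogeneousComponent_eq_zero 1 p hp, add_zero]
    conv_lhs => rw [← sum_homogeneousComponent p, show p.totalDegree = 0 by lia]
  · conv_lhs => rw [← sum_homogeneousComponent p, hp]

section LinearCombinations

variable {k : Type*} [Field k] {σ : Type*} [LinearOrder σ]

theorem exists_hasLevel_aeval_of_totalDegree_le_one [Finite σ] {τ : σ → MvPolynomial σ k}
    (hτ : ∀ i, HasLevel i (τ i)) {p : MvPolynomial σ k} (hp : p.totalDegree ≤ 1)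
    (hpC : ∀ c, p ≠ C c) : ∃ m, HasLevel m (aeval τ p) := by
  cases nonempty_fintype σ
  obtain ⟨c, a, rfl⟩ := exists_eq_C_add_sum_smul_X_of_totalDegree_le_one hp
  obtain ⟨m, hm⟩ := exists_hasLevel_linearCombination hτ (a := a) (fun ha => hpC c (by
    simp only [ha, Pi.zero_apply, zero_smul, Finset.sum_const_zero, add_zero])) c
  refine ⟨m, ?_⟩
  simpa only [map_add, map_sum, map_smul, aeval_X, algHom_C, algebraMap_eq] using hm

variable {ι : Type*} [Fintype ι] [LinearOrder ι] [WellFoundedLT σ] {f : ι → MvPolynomial σ k}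

theorem exists_minimal_hasLevel (hf : ∀ b : ι → k, b ≠ 0 → ∃ m, HasLevel m (∑ i, b i • f i))
    (i : ι) : ∃ (b : ι → k) (m : σ), b i = 1 ∧ (∀ j, i < j → b j = 0) ∧
      HasLevel m (∑ j, b j • f j) ∧ ∀ b' : ι → k, b' i = 1 → (∀ j, i < j → b' j = 0) →
        ¬∃ m' < m, HasLevel m' (∑ j, b' j • f j) := by
  let S : Set σ := {m | ∃ b : ι → k, b i = 1 ∧ (∀ j, i < j → b j = 0) ∧
    HasLevel m (∑ j, b j • f j)}
  have hS : S.Nonempty := by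
    obtain ⟨m, hm⟩ := hf (Pi.single i 1) (Pi.single_ne_zero_iff.2 one_ne_zero)
    exact ⟨m, _, Pi.single_eq_same i 1, fun j hj => Pi.single_eq_of_ne hj.ne' 1, hm⟩
  obtain ⟨b, hb, hb0, hm⟩ := WellFounded.min_mem wellFounded_lt S hS
  refine ⟨b, _, hb, hb0, hm, fun b' hb' hb'0 ⟨m', hlt, hm'⟩ => ?_⟩
  exact WellFounded.not_lt_min wellFounded_lt S ⟨b', hb', hb'0, hm'⟩ hlt

theorem exists_unitriangular_injective_hasLevel
    (hf : ∀ b : ι → k, b ≠ 0 → ∃ m, HasLevel m (∑ i, b i • f i)) :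
    ∃ (B : Matrix ι ι k) (π : ι → σ), (∀ i, B i i = 1) ∧ B.IsLowerTriangular ∧
      Function.Injective π ∧ ∀ i, HasLevel (π i) (∑ j, B i j • f j) := by
  choose B π hB hB0 hπ hmin using exists_minimal_hasLevel hf
  have hne {i j : ι} (hji : j < i) : π i ≠ π j := by
    intro heq
    obtain ⟨c, hc⟩ := (hπ i).exists_sub_smul_mem_supported (heq ▸ hπ j)
    have hb : (B i - c • B j) i = 1 := by
      rw [Pi.sub_apply, Pi.smul_apply, hB, hB0 j i hji, smul_zero, sub_zero]
    have hsum : ∑ l, (B i - c • B j) l • f l = ∑ l, B i l • f l - c • ∑ l, B j l • f l := by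
      simp only [Pi.sub_apply, Pi.smul_apply, sub_smul, smul_eq_mul, mul_smul, Finset.smul_sum,
        Finset.sum_sub_distrib]
    obtain ⟨m, hm⟩ := hf (B i - c • B j) fun h0 => one_ne_zero (hb.symm.trans (congrFun h0 i))
    refine hmin i _ hb (fun l hl => ?_) ⟨m, hm.lt_of_mem (hsum ▸ hc), hm⟩
    rw [Pi.sub_apply, Pi.smul_apply, hB0 i l hl, hB0 j l (hji.trans hl), smul_zero, sub_zero]
  refine ⟨B, π, hB, fun i j hij => hB0 i j hij, fun i j hij => ?_, hπ⟩
  by_contra hij'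
  rcases lt_or_gt_of_ne hij' with hlt | hlt
  · exact hne hlt hij.symm
  · exact hne hlt hij

end LinearCombinations

namespace AffEnd

variable {k : Type*} [Field k] {n : ℕ}

theorem adjoin_image_Iio_le_supported {τ : AffEnd k n} (hτ : IsTriangular τ) (N : Fin n) :
    Algebra.adjoin k (τ '' Set.Iio N) ≤ supported k (Set.Iio N) := by
  refine Algebra.adjoin_le ?_
  rintro _ ⟨i, hi, rfl⟩
  exact supported_mono (Set.Iic_subset_Iio.2 hi) (hτ i)

theorem mem_adjoin_image_Iic {τ : AffEnd k n} {N : Fin n} {p : MvPolynomial (Fin n) k} :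
    p ∈ Algebra.adjoin k (τ '' Set.Iic N) ↔
      p ∈ Algebra.adjoin (Algebra.adjoin k (τ '' Set.Iio N)) {τ N} := by
  rw [← Set.Iio_union_right, Set.image_union, Set.image_singleton,
    Algebra.adjoin_union_eq_adjoin_adjoin, Subalgebra.mem_restrictScalars]

theorem hasLevel_of_X_mem_adjoin {τ : AffEnd k n} (hτ : IsTriangular τ) {N : Fin n}
    (h : X N ∈ Algebra.adjoin k (τ '' Set.Iic N)) : HasLevel N (τ N) :=
  .of_X_mem_adjoin_singleton ((adjoin_image_Iio_le_supported hτ N).trans supported_Iio_le_compl)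
    (hτ N) (mem_adjoin_image_Iic.1 h)

theorem hasLevel_of_isTriangular {τ g : AffEnd k n} (hτ : IsTriangular τ)
    (h : comp g τ = one k n) (i : Fin n) : HasLevel i (τ i) := by
  obtain _ | n := n
  · exact i.elim0
  have hX (N : Fin (n + 1)) : ∀ i ≤ N, X i ∈ Algebra.adjoin k (τ '' Set.Iic N) := by
    induction N using Fin.reverseInduction with
    | last =>
      intro i _
      rw [show X i = aeval τ (g i) from (congrFun h i).symm,
        show Set.Iic (Fin.last n) = Set.univ from Set.Iic_top, Set.image_univ,
        Algebra.adjoin_range_eq_range_aeval]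
      exact ⟨g i, rfl⟩
    | cast N ih =>
      intro i hi
      have hiN : i < N.succ := hi.trans_lt N.castSucc_lt_succ
      have hmem := mem_of_mem_adjoin_singleton
        ((adjoin_image_Iio_le_supported hτ N.succ).trans supported_Iio_le_compl)
        (hasLevel_of_X_mem_adjoin hτ (ih _ le_rfl)).notMem_supported
        (X_mem_supported.2 hiN.ne) (mem_adjoin_image_Iic.1 (ih i hiN.le))
      rwa [show Set.Iio N.succ = Set.Iic N.castSucc from
        Set.ext fun _ => Fin.le_castSucc_iff.symm] at hmem
  exact hasLevel_of_X_mem_adjoin hτ (hX i i le_rfl)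

theorem sum_smul_ne_C {α α' : AffEnd k n} (h : comp α α' = one k n) {b : Fin n → k} (hb : b ≠ 0)
    (c : k) : ∑ i, b i • α i ≠ C c := by
  intro hC
  have hX : ∑ i, b i • X i = (C c : MvPolynomial (Fin n) k) := by
    rw [← algebraMap_eq, ← algHom_C (aeval α'), ← hC, map_sum]
    refine Finset.sum_congr rfl fun i _ => ?_
    rw [map_smul, show X i = aeval α' (α i) from (congrFun h i).symm]
  refine hb (funext fun i => ?_)
  have hcoeff := congrArg (coeff (Finsupp.single i 1)) hX
  simpa [coeff_sum, coeff_X, Finsupp.single_left_inj, coeff_C, Finsupp.single_eq_zero, eq_comm]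
    using hcoeff

theorem exists_hasLevel_sum_smul {α α' τ : AffEnd k n} (h : comp α α' = one k n) (hα : deg α ≤ 1)
    (hτ : ∀ i, HasLevel i (τ i)) {b : Fin n → k} (hb : b ≠ 0) :
    ∃ m, HasLevel m (∑ i, b i • comp α τ i) := by
  have hdeg : (∑ i, b i • α i).totalDegree ≤ 1 :=
    totalDegree_finsetSum_le fun i _ =>
      (totalDegree_smul_le _ _).trans ((totalDegree_le_deg α i).trans hα)
  obtain ⟨m, hm⟩ := exists_hasLevel_aeval_of_totalDegree_le_one hτ hdeg (sum_smul_ne_C h hb)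
  refine ⟨m, ?_⟩
  simp only [map_sum, map_smul] at hm
  exact hm

theorem toMvPolynomial_eq_sum_smul (B : Matrix (Fin n) (Fin n) k) (i : Fin n) :
    B.toMvPolynomial i = ∑ j, B i j • X j :=
  Finset.sum_congr rfl fun j _ => by rw [← C_mul_X_eq_monomial, C_mul']

theorem isTriangular_toMvPolynomial {B : Matrix (Fin n) (Fin n) k}
    (hB : B.IsLowerTriangular) : IsTriangular B.toMvPolynomial := by
  intro i
  rw [toMvPolynomial_eq_sum_smul]
  refine sum_mem fun j _ => ?_
  obtain hji | hij := le_or_gt j i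
  · exact Subalgebra.smul_mem (supported k {j | j ≤ i}) (X_mem_supported.2 hji) _
  · rw [hB hij, zero_smul]
    exact zero_mem _

theorem comp_toMvPolynomial {B B' : Matrix (Fin n) (Fin n) k} (h : B * B' = 1) :
    comp B.toMvPolynomial B'.toMvPolynomial = one k n := by
  funext i
  rw [comp, aeval_eq_bind₁, ← Matrix.toMvPolynomial_mul, h, Matrix.toMvPolynomial_one]
  rfl

theorem exists_conj_hasLevel {f : AffEnd k n} (hf : IsAutomorphism f) (hf' : IsAffineTriangular f) :
    ∃ (β β' : AffEnd k n) (π : Fin n → Fin n), comp β β' = one k n ∧ comp β' β = one k n ∧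
      Function.Injective π ∧ ∀ i, HasLevel (π i) (comp (comp β f) β' i) := by
  obtain ⟨α, τ, ⟨⟨α', hα, -⟩, hdeg⟩, hτ, rfl⟩ := hf'
  obtain ⟨g, -, hg⟩ := hf
  have hlevel := hasLevel_of_isTriangular hτ (g := comp g α) (by rw [comp_assoc, hg])
  obtain ⟨B, π, hB1, hB, hπ, hBπ⟩ := exists_unitriangular_injective_hasLevel fun b hb =>
    exists_hasLevel_sum_smul hα hdeg.le hlevel hb
  have hdet : IsUnit B.det := by
    rw [Matrix.det_of_isLowerTriangular B hB, Finset.prod_congr rfl fun i _ => hB1 i,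
      Finset.prod_const_one]
    exact isUnit_one
  have := B.invertibleOfIsUnitDet hdet
  have hB' := Matrix.blockTriangular_inv_of_blockTriangular hB
  have hβ := comp_toMvPolynomial (B.mul_nonsing_inv hdet)
  refine ⟨B.toMvPolynomial, B⁻¹.toMvPolynomial, π, hβ,
    comp_toMvPolynomial (B.nonsing_inv_mul hdet), hπ, fun i => ?_⟩
  refine HasLevel.aeval ?_ (hasLevel_of_isTriangular (isTriangular_toMvPolynomial hB') hβ)
  rw [comp, toMvPolynomial_eq_sum_smul, map_sum]
  simpa only [map_smul, aeval_X] using hBπ i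

end AffEnd

end AffineTriangular

section AlgebraicIndependence

variable {k : Type*} [Field k] {σ τ : Type*}

theorem eq_zero_of_mem_supported_of_aeval_eq_zero {A : Type*} [CommRing A] [Algebra k A]
    {s : Set σ} {u : σ → A} (hu : AlgebraicIndepOn k u s) {p : MvPolynomial σ k}
    (hp : p ∈ supported k s) (h : aeval u p = 0) : p = 0 := by
  rw [supported_eq_range_rename] at hp
  obtain ⟨q, rfl⟩ := hp
  change aeval u (rename Subtype.val q) = 0 at h
  rw [aeval_rename] at h
  change rename Subtype.val q = 0
  rw [hu.eq_zero_of_aeval_eq_zero q h, map_zero]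

theorem algebraicIndepOn_insert {s : Set σ} {u : σ → MvPolynomial τ k} {a : σ} {t : τ}
    (hs : AlgebraicIndepOn k u s) (hu : ∀ i ∈ s, u i ∈ supported k {t}ᶜ)
    (ha : u a ∉ supported k {t}ᶜ) : AlgebraicIndepOn k u (insert a s) := by
  refine hs.insert (transcendental_of_notMem_supported (Algebra.adjoin_le ?_) ha)
  rintro _ ⟨i, hi, rfl⟩
  exact hu i hi

theorem algebraicIndepOn_singleton {u : σ → MvPolynomial τ k} {a : σ} {t : τ}
    (ha : u a ∉ supported k {t}ᶜ) : AlgebraicIndepOn k u {a} := by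
  rw [← insert_empty_eq]
  exact algebraicIndepOn_insert
    (algebraicIndependent_empty_type_iff.2 (FaithfulSMul.algebraMap_injective k _))
    (fun i hi => hi.elim) ha

theorem apply_eq_zero_of_mem_supported {s : Set σ} {p : MvPolynomial σ k}
    (hp : p ∈ supported k s) {m : σ →₀ ℕ} (hm : coeff m p ≠ 0) {i : σ} (hi : i ∉ s) : m i = 0 := by
  by_contra h
  exact hi (mem_supported.1 hp ((mem_vars_iff_mem_support i).2 ⟨m, mem_support_iff.2 hm,
    Finsupp.mem_support_iff.2 h⟩))

theorem weightedHomogeneousComponent_mem_supported {M : Type*} [AddCommMonoid M] {μ : σ → M}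
    {w : M} {s : Set σ} {p : MvPolynomial σ k} (hp : p ∈ supported k s) :
    weightedHomogeneousComponent μ w p ∈ supported k s := by
  classical
  refine mem_supported.2 fun i hi => ?_
  obtain ⟨m, hm, hmi⟩ := (mem_vars_iff_mem_support i).1 hi
  rw [support_weightedHomogeneousComponent, Finset.mem_filter, mem_support_iff] at hm
  by_contra his
  exact Finsupp.mem_support_iff.1 hmi (apply_eq_zero_of_mem_supported hp hm.1 his)

theorem weightedHomogeneousComponent_notMem_supported {M : Type*} [AddCommMonoid M] {μ : σ → M}
    {w : M} {s : Set σ} {p : MvPolynomial σ k} {m : σ →₀ ℕ} (hm : coeff m p ≠ 0)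
    (hw : Finsupp.weight μ m = w) {i : σ} (hi : m i ≠ 0) (his : i ∉ s) :
    weightedHomogeneousComponent μ w p ∉ supported k s := by
  classical
  refine fun h => hi (apply_eq_zero_of_mem_supported (m := m) h ?_ his)
  rwa [coeff_weightedHomogeneousComponent, if_pos hw]

theorem smul_X_pow_notMem_supported_compl {c : k} (hc : c ≠ 0) {d : ℕ} (hd : d ≠ 0) (t : σ) :
    c • (X t : MvPolynomial σ k) ^ d ∉ supported k {t}ᶜ := by
  classical
  refine fun h => hd ?_
  have hcoeff : coeff (Finsupp.single t d) (c • (X t : MvPolynomial σ k) ^ d) ≠ 0 := by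
    rwa [coeff_smul, coeff_X_pow, if_pos rfl, smul_eq_mul, mul_one]
  simpa only [Finsupp.single_eq_same] using
    apply_eq_zero_of_mem_supported h hcoeff (i := t) (fun h => h rfl)

end AlgebraicIndependence

namespace AffEnd

variable {k : Type*} [Field k] {n : ℕ} {g : AffEnd k n}

theorem iter_ne_zero {s : Set (Fin n)} (hs : ∀ i ∈ s, g i ∈ supported k s)
    (hg : AlgebraicIndepOn k g s) {i : Fin n} (hi : i ∈ s) (r : ℕ) : iter g r i ≠ 0 := by
  suffices iter g r i ∈ supported k s ∧ iter g r i ≠ 0 from this.2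
  induction r with
  | zero => exact ⟨X_mem_supported.2 hi, X_ne_zero i⟩
  | succ r ih =>
    rw [iter_succ']
    exact ⟨aeval_mem_of_mem_supported ih.1 hs,
      fun h => ih.2 (eq_zero_of_mem_supported_of_aeval_eq_zero hg ih.1 h)⟩

variable {i j : Fin n}

theorem iter_ne_zero_of_mem_supported_singleton (hi : g i ∈ supported k {i})
    (hi' : g i ∉ supported k {i}ᶜ) (r : ℕ) : iter g r i ≠ 0 := by
  refine iter_ne_zero (s := {i}) ?_ (algebraicIndepOn_singleton hi') rfl r
  rintro _ rfl
  exact hi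

theorem iter_ne_zero_of_skew (hi : g i ∈ supported k {i, j}) (hi' : g i ∉ supported k {i}ᶜ)
    (hij : i ≠ j) (hj : g j ∈ supported k {j}) (hj' : g j ∉ supported k {j}ᶜ) (r : ℕ) :
    iter g r i ≠ 0 := by
  refine iter_ne_zero (s := {i, j}) ?_ (algebraicIndepOn_insert (t := i)
    (algebraicIndepOn_singleton hj') ?_ hi') (Set.mem_insert i _) r
  · rintro _ (rfl | rfl)
    · exact hi
    · exact supported_mono (Set.subset_insert _ _) hj
  · rintro _ rfl
    exact supported_mono (Set.singleton_subset_iff.2 hij.symm) hj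

theorem iter_ne_zero_of_shift (hi : g i ∈ supported k {i, j}) (hi' : g i ∉ supported k {i, j}ᶜ)
    (hij : i ≠ j) (hj : g j ∈ supported k {i}) (hj' : g j ∉ supported k {i}ᶜ) (r : ℕ) :
    iter g r i ≠ 0 := by
  by_cases hgj : g i ∈ supported k {j}ᶜ
  · refine iter_ne_zero_of_mem_supported_singleton (mem_supported.2 fun m hm => ?_)
      (fun hgi => hi' (mem_supported.2 fun m hm => ?_)) r
    · exact (mem_supported.1 hi hm).resolve_right (mem_supported.1 hgj hm)
    · exact fun h => h.elim (mem_supported.1 hgi hm) (mem_supported.1 hgj hm)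
  · have hindep : AlgebraicIndepOn k g {i, j} :=
      algebraicIndepOn_insert (algebraicIndepOn_singleton hj')
        (by rintro _ rfl; exact supported_mono (Set.singleton_subset_iff.2 hij) hj) hgj
    refine iter_ne_zero (s := {i, j}) ?_ hindep (Set.mem_insert i _) r
    rintro _ (rfl | rfl)
    · exact hi
    · exact supported_mono (Set.singleton_subset_iff.2 (Set.mem_insert i _)) hj

end AffEnd

section WeightEstimates

variable {σ R K : Type*} [CommRing R] [Semiring K] [PartialOrder K] [IsStrictOrderedRing K]
  {μ : σ → K} {w : K} {i : σ}

theorem aeval_X_mem_weightLE {P : Polynomial R} (hi : 0 ≤ μ i) (h : P.natDegree * μ i ≤ w) :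
    Polynomial.aeval (X i : MvPolynomial σ R) P ∈ weightLE R μ w := by
  rw [Polynomial.aeval_eq_sum_range]
  refine sum_mem fun e he => Submodule.smul_mem _ _ ?_
  refine weightLE_mono ?_ (pow_mem_weightLE (X_mem_weightLE le_rfl) e)
  rw [nsmul_eq_mul]
  exact (mul_le_mul_of_nonneg_right
    (Nat.cast_le.2 (Nat.lt_succ_iff.1 (Finset.mem_range.1 he))) hi).trans h

theorem hasTop_aeval_X (hi : 0 < μ i) (P : Polynomial R) :
    HasTop μ (P.natDegree * μ i) (Polynomial.aeval (X i : MvPolynomial σ R) P)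
      (P.leadingCoeff • X i ^ P.natDegree) := by
  rw [Polynomial.aeval_eq_sum_range, Finset.sum_range_succ, add_comm, ← nsmul_eq_mul]
  refine (((HasTop.X i).pow P.natDegree).smul P.leadingCoeff).add_right
    (sum_mem fun e he => Submodule.smul_mem _ _ ?_)
  refine weightLE_le_weightLT ?_ (pow_mem_weightLE (X_mem_weightLE le_rfl) e)
  exact nsmul_lt_nsmul_left hi (Finset.mem_range.1 he)

theorem mem_weightLE_of_mem_supported {k : Type*} [Field k] {p : MvPolynomial σ k} {s : Set σ}
    (hp : p ∈ supported k s) (hw : 0 ≤ w) (h : ∀ i ∈ s, μ i ≤ w) :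
    p ∈ weightLE k μ (p.totalDegree * w) := by
  refine mem_weightLE.2 fun m hm => ?_
  calc Finsupp.weight μ m ≤ ∑ i ∈ m.support, m i • w :=
        Finset.sum_le_sum fun i hi => nsmul_le_nsmul_right (h i ?_) (m i)
    _ = (m.degree : K) * w := by rw [← Finset.sum_smul, ← Finsupp.degree_apply, nsmul_eq_mul]
    _ ≤ p.totalDegree * w :=
        mul_le_mul_of_nonneg_right (Nat.cast_le.2 (le_totalDegree (mem_support_iff.2 hm))) hw
  by_contra his
  exact Finsupp.mem_support_iff.1 hi (apply_eq_zero_of_mem_supported hp hm his)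

section ThreeVariables

variable {k : Type*} [Field k] {Q : MvPolynomial (Fin 3) k} {a b c : K}

theorem weight_vec_three_of_mem_supported (hQ : Q ∈ supported k {0, 1}) {m : Fin 3 →₀ ℕ}
    (hm : coeff m Q ≠ 0) : Finsupp.weight ![a, b, c] m = m 0 * a + m 1 * b := by
  have hm2 : m 2 = 0 := apply_eq_zero_of_mem_supported hQ hm (by decide)
  simp [Finsupp.weight_eq_sum, Fin.sum_univ_three, hm2]

theorem mem_weightLE_vec_three_iff (hQ : Q ∈ supported k {0, 1}) :
    Q ∈ weightLE k ![a, b, c] w ↔ ∀ m, coeff m Q ≠ 0 → m 0 * a + m 1 * b ≤ w := by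
  rw [mem_weightLE]
  exact forall₂_congr fun m hm => by rw [weight_vec_three_of_mem_supported hQ hm]

end ThreeVariables

end WeightEstimates

/-- The real number `θ` is the largest of the positive roots of the equations
`x ^ 2 = a j * x + b j`. -/
theorem exists_one_lt_forall_le_sq_and_eq {ι : Type*} {S : Finset ι} {a b : ι → ℝ}
    (hb : ∀ j ∈ S, 0 ≤ b j) (h : ∃ j ∈ S, 1 < a j + b j) :
    ∃ θ, 1 < θ ∧ (∀ j ∈ S, a j * θ + b j ≤ θ ^ 2) ∧ ∃ j ∈ S, a j * θ + b j = θ ^ 2 := by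
  obtain ⟨j₀, hj₀, hj₀'⟩ := h
  have hS : S.Nonempty := ⟨j₀, hj₀⟩
  set F : ℝ → ℝ := fun x => S.sup' hS fun j => a j * x + b j
  set T := S.sup' hS fun j => a j + b j
  have hF : Continuous F := Continuous.finset_sup'_apply hS fun j _ => by fun_prop
  have hT : 1 < T := hj₀'.trans_le (Finset.le_sup' (fun j => a j + b j) hj₀)
  have hF1 : (1 : ℝ) ^ 2 - F 1 < 0 := by
    simpa only [F, mul_one, one_pow, sub_neg] using hT
  have hFT : 0 ≤ T ^ 2 - F T := by
    refine sub_nonneg.2 (Finset.sup'_le _ _ fun j hj => ?_)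
    have hjT : a j + b j ≤ T := Finset.le_sup' (fun j => a j + b j) hj
    nlinarith [hb j hj]
  obtain ⟨θ, ⟨hθ, -⟩, hroot⟩ :=
    intermediate_value_Icc hT.le ((continuous_pow 2).sub hF).continuousOn ⟨hF1.le, hFT⟩
  have hFθ : F θ = θ ^ 2 := (sub_eq_zero.1 hroot).symm
  refine ⟨θ, lt_of_le_of_ne hθ ?_, fun j hj => ?_, ?_⟩
  · rintro rfl
    exact hF1.ne hroot
  · rw [← hFθ]
    exact Finset.le_sup' (fun j => a j * θ + b j) hj
  · obtain ⟨j, hj, hjθ⟩ := Finset.exists_mem_eq_sup' hS fun j => a j * θ + b j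
    exact ⟨j, hj, hjθ.symm.trans hFθ⟩

namespace AffEnd

variable {k : Type*} [Field k] {l : ℝ}

theorem IsDynamicalDegree.le_one_of_hasLevel {n : ℕ} {f : AffEnd k n}
    (hl : IsDynamicalDegree f l) (hf : ∀ i, HasLevel i (f i)) : l ≤ 1 := by
  choose c _ q hq hfq using hf
  obtain ⟨D, hD⟩ := Finite.exists_le fun i => (q i).totalDegree
  have hD0 : (0 : ℝ) < D + 1 := Nat.cast_add_one_pos D
  refine hl.le_of_weight (μ := fun i => ((D : ℝ) + 1) ^ (i : ℕ)) zero_le_one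
    (fun i => pow_pos hD0 _) fun i => ?_
  rw [one_mul, hfq]
  refine add_mem (smul_X_mem_weightLE (c i) le_rfl) (weightLE_mono ?_
    (mem_weightLE_of_mem_supported (w := ((D : ℝ) + 1) ^ (i : ℕ) / (D + 1)) (hq i)
      (by positivity) fun j hj => ?_))
  · rw [← mul_div_assoc, div_le_iff₀ hD0, mul_comm]
    refine mul_le_mul_of_nonneg_left ?_ (by positivity)
    exact (Nat.cast_le.2 (hD i)).trans (le_add_of_nonneg_right zero_le_one)
  · rw [le_div_iff₀ hD0, ← pow_succ]
    exact pow_le_pow_right₀ (le_add_of_nonneg_left D.cast_nonneg) hj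

/-- The property of `l` obstructed by a negative constant term in its minimal polynomial. -/
def LeOneOrQuadratic (l : ℝ) : Prop :=
  l ≤ 1 ∨ ∃ a b : ℕ, l ^ 2 = a * l + b

theorem LeOneOrQuadratic.natCast (a : ℕ) : LeOneOrQuadratic a :=
  Or.inr ⟨a, 0, by rw [Nat.cast_zero, add_zero, sq]⟩

variable {f : AffEnd k 3} {c₀ d₀ c₁ d₁ c₂ : k} {P : Polynomial k} {Q : MvPolynomial (Fin 3) k}

section Planar

theorem planar_mem_weightLE (hQ : Q ∈ supported k {0, 1})
    (h0 : f 0 = c₁ • X 1 + Polynomial.aeval (X 0) P) (h1 : f 1 = c₀ • X 0 + C d₀)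
    (h2 : f 2 = c₂ • X 2 + Q) {δ : ℝ} (hδ : 1 ≤ δ) (hP : P.natDegree ≤ δ) (i : Fin 3) :
    f i ∈ weightLE k ![δ, 1, (Q.totalDegree + 1) * δ]
      (δ * ![δ, 1, (Q.totalDegree + 1) * δ] i) := by
  have hδ0 : 0 ≤ δ := zero_le_one.trans hδ
  have hδδ : δ ≤ δ * δ := le_mul_of_one_le_right hδ0 hδ
  match i with
  | 0 =>
    rw [h0]
    exact add_mem (smul_X_mem_weightLE _ (hδ.trans hδδ))
      (aeval_X_mem_weightLE hδ0 (mul_le_mul_of_nonneg_right hP hδ0))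
  | 1 =>
    rw [h1]
    exact add_mem (smul_X_mem_weightLE _ (mul_one δ).ge)
      (C_mem_weightLE _ (mul_nonneg hδ0 zero_le_one))
  | 2 =>
    have hQδ : 0 ≤ (Q.totalDegree + 1) * δ := by positivity
    have hX : (Q.totalDegree + 1) * δ ≤ δ * ((Q.totalDegree + 1) * δ) :=
      le_mul_of_one_le_left hQδ hδ
    rw [h2]
    refine add_mem (smul_X_mem_weightLE _ hX) (weightLE_mono ?_
      (mem_weightLE_of_mem_supported hQ hδ0 ?_))
    · exact (mul_le_mul_of_nonneg_right (lt_add_one _).le hδ0).trans hX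
    · rintro _ (rfl | rfl)
      exacts [le_rfl, hδ]

theorem IsDynamicalDegree.leOneOrQuadratic_of_planar (hl : IsDynamicalDegree f l)
    (hQ : Q ∈ supported k {0, 1}) (h0 : f 0 = c₁ • X 1 + Polynomial.aeval (X 0) P)
    (h1 : f 1 = c₀ • X 0 + C d₀) (h2 : f 2 = c₂ • X 2 + Q) : LeOneOrQuadratic l := by
  have hle {δ : ℝ} (hδ : 1 ≤ δ) (hP : P.natDegree ≤ δ) : l ≤ δ :=
    have hδ0 : 0 < δ := zero_lt_one.trans_le hδ
    hl.le_of_weight hδ0.le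
      (fun | 0 => hδ0 | 1 => one_pos | 2 => mul_pos (Nat.cast_add_one_pos _) hδ0)
      (planar_mem_weightLE hQ h0 h1 h2 hδ hP)
  rcases le_or_gt P.natDegree 1 with hP | hP
  · exact Or.inl (hle le_rfl (Nat.cast_le_one.2 hP))
  have hδ : (1 : ℝ) < P.natDegree := Nat.one_lt_cast.2 hP
  have hδ0 : (0 : ℝ) < P.natDegree := zero_lt_one.trans hδ
  set μ : Fin 3 → ℝ := ![P.natDegree, 1, (Q.totalDegree + 1) * P.natDegree]
  have hδδ : (1 : ℝ) < P.natDegree * P.natDegree := one_lt_mul_of_lt_of_le hδ hδ.le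
  have htop : leadingPart μ P.natDegree f 0 = P.leadingCoeff • X 0 ^ P.natDegree :=
    (leadingPart_eq_of_eq_smul_X_add h0 hδδ.ne).trans
      (hasTop_aeval_X (μ := μ) (i := 0) hδ0 P).weightedHomogeneousComponent_eq
  have hne : ∀ r, iter (leadingPart μ P.natDegree f) r 0 ≠ 0 := by
    refine iter_ne_zero_of_mem_supported_singleton ?_ ?_ <;> rw [htop]
    · exact Subalgebra.smul_mem _ (pow_mem (X_mem_supported.2 (Set.mem_singleton 0)) _) _
    · exact smul_X_pow_notMem_supported_compl
        (Polynomial.leadingCoeff_ne_zero.2 (Polynomial.ne_zero_of_natDegree_gt hP))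
        (Nat.ne_zero_of_lt hP) 0
  have hge : P.natDegree ≤ l :=
    hl.ge_of_weight hδ0 (planar_mem_weightLE hQ h0 h1 h2 hδ.le le_rfl) (i := 0) hδ0 hne
  rw [le_antisymm (hle hδ.le le_rfl) hge]
  exact LeOneOrQuadratic.natCast _

end Planar

section Fibration

theorem IsDynamicalDegree.le_of_fibration (hl : IsDynamicalDegree f l)
    (hQ : Q ∈ supported k {0, 1}) (h0 : f 0 = c₂ • X 2 + Q) (h1 : f 1 = c₁ • X 1 + C d₁)
    (h2 : f 2 = c₀ • X 0 + Polynomial.aeval (X 1) P) {θ : ℝ} (hθ : 1 ≤ θ)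
    (hQθ : Q.degreeOf 0 < θ) : l ≤ θ := by
  have hθe : 0 < θ - Q.degreeOf 0 := sub_pos.2 hQθ
  set N : ℝ := (Q.totalDegree + 1) / (θ - Q.degreeOf 0) + P.natDegree with hN
  have hN0 : 0 < N := by positivity
  have hPN : P.natDegree ≤ N := le_add_of_nonneg_left (by positivity)
  have hQN : Q.totalDegree ≤ (θ - Q.degreeOf 0) * N := by
    rw [hN, mul_add, mul_div_cancel₀ _ hθe.ne']
    have : 0 ≤ (θ - Q.degreeOf 0) * P.natDegree := by positivity
    linarith
  have hNθ : N ≤ θ * N := le_mul_of_one_le_left hN0.le hθ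
  refine hl.le_of_weight (μ := ![N, 1, N]) (zero_le_one.trans hθ)
    (fun | 0 => hN0 | 1 => one_pos | 2 => hN0) fun i => ?_
  match i with
  | 0 =>
    rw [h0]
    refine add_mem (smul_X_mem_weightLE _ hNθ) ((mem_weightLE_vec_three_iff hQ).2 fun m hm => ?_)
    have hm0 : (m 0 : ℝ) ≤ Q.degreeOf 0 :=
      Nat.cast_le.2 (monomial_le_degreeOf 0 (mem_support_iff.2 hm))
    have hm1 : (m 1 : ℝ) ≤ Q.totalDegree :=
      Nat.cast_le.2 ((m.le_degree 1).trans (le_totalDegree (mem_support_iff.2 hm)))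
    calc m 0 * N + m 1 * 1 ≤ Q.degreeOf 0 * N + (θ - Q.degreeOf 0) * N := by
          rw [mul_one]
          exact add_le_add (mul_le_mul_of_nonneg_right hm0 hN0.le) (hm1.trans hQN)
      _ = θ * N := by ring
  | 1 =>
    rw [h1]
    exact add_mem (smul_X_mem_weightLE _ (hθ.trans_eq (mul_one θ).symm))
      (C_mem_weightLE _ (mul_nonneg (zero_le_one.trans hθ) zero_le_one))
  | 2 =>
    rw [h2]
    exact add_mem (smul_X_mem_weightLE _ hNθ)
      (aeval_X_mem_weightLE zero_le_one ((mul_one _).trans_le (hPN.trans hNθ)))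

theorem fibration_mem_weightLE (hQ : Q ∈ supported k {0, 1}) (h0 : f 0 = c₂ • X 2 + Q)
    (h1 : f 1 = c₁ • X 1 + C d₁) (h2 : f 2 = c₀ • X 0 + Polynomial.aeval (X 1) P) {e : ℝ}
    (he : 1 ≤ e) (hQe : Q.degreeOf 0 ≤ e) (i : Fin 3) :
    f i ∈ weightLE k ![e, 0, 1] (e * ![e, 0, 1] i) := by
  have he0 : 0 ≤ e := zero_le_one.trans he
  match i with
  | 0 =>
    rw [h0]
    refine add_mem (smul_X_mem_weightLE _ (one_le_mul_of_one_le_of_one_le he he))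
      ((mem_weightLE_vec_three_iff hQ).2 fun m hm => ?_)
    rw [mul_zero, add_zero]
    exact mul_le_mul_of_nonneg_right ((Nat.cast_le.2
      (monomial_le_degreeOf 0 (mem_support_iff.2 hm))).trans hQe) he0
  | 1 =>
    rw [h1]
    exact add_mem (smul_X_mem_weightLE _ (mul_zero e).ge) (C_mem_weightLE _ (mul_zero e).ge)
  | 2 =>
    rw [h2]
    exact add_mem (smul_X_mem_weightLE _ (mul_one e).ge) (aeval_X_mem_weightLE (le_refl (0 : ℝ))
      ((mul_zero _).trans_le (mul_nonneg he0 zero_le_one)))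

theorem IsDynamicalDegree.degreeOf_le_of_fibration (hl : IsDynamicalDegree f l) (hc₁ : c₁ ≠ 0)
    (hQ : Q ∈ supported k {0, 1}) (h0 : f 0 = c₂ • X 2 + Q) (h1 : f 1 = c₁ • X 1 + C d₁)
    (h2 : f 2 = c₀ • X 0 + Polynomial.aeval (X 1) P) (he : 1 < Q.degreeOf 0) :
    (Q.degreeOf 0 : ℝ) ≤ l := by
  have he1 : (1 : ℝ) < Q.degreeOf 0 := Nat.one_lt_cast.2 he
  have he0 : (0 : ℝ) < Q.degreeOf 0 := zero_lt_one.trans he1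
  set e : ℝ := (Q.degreeOf 0 : ℝ) with he_def
  set μ : Fin 3 → ℝ := ![e, 0, 1]
  have hf := fibration_mem_weightLE hQ h0 h1 h2 he1.le he_def.ge
  have htop0 : leadingPart μ e f 0 = weightedHomogeneousComponent μ (e * e) Q :=
    leadingPart_eq_of_eq_smul_X_add h0 (one_lt_mul_of_lt_of_le he1 he1.le).ne
  have htop1 : leadingPart μ e f 1 = c₁ • X 1 + C d₁ := by
    rw [leadingPart, h1, show e * μ 1 = 0 from mul_zero e, smul_eq_C_mul]
    exact (((isWeightedHomogeneous_X k μ 1).C_mul c₁).add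
      (isWeightedHomogeneous_C μ d₁)).weightedHomogeneousComponent_same
  obtain ⟨m, hm, hme⟩ := Q.support.exists_mem_eq_sup
    (support_nonempty.2 (by rintro rfl; simp at he)) fun m => m 0
  rw [← degreeOf_eq_sup] at hme
  rw [mem_support_iff] at hm
  have hw : Finsupp.weight μ m = e * e := by
    rw [weight_vec_three_of_mem_supported hQ hm, mul_zero, add_zero, ← hme]
  refine hl.ge_of_weight he0 hf (i := 0) he0
    (iter_ne_zero_of_skew (j := 1) ?_ ?_ (by decide) ?_ ?_)
  · rw [htop0]
    exact weightedHomogeneousComponent_mem_supported hQ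
  · rw [htop0]
    exact weightedHomogeneousComponent_notMem_supported hm hw (i := 0) (by omega) (fun h => h rfl)
  · rw [htop1]
    exact add_mem (Subalgebra.smul_mem _ (X_mem_supported.2 (Set.mem_singleton 1)) _)
      (Subalgebra.algebraMap_mem _ d₁)
  · rw [htop1]
    exact HasLevel.notMem_supported ⟨c₁, hc₁, C d₁, Subalgebra.algebraMap_mem _ d₁, rfl⟩

theorem IsDynamicalDegree.leOneOrQuadratic_of_fibration (hl : IsDynamicalDegree f l)
    (hc₁ : c₁ ≠ 0) (hQ : Q ∈ supported k {0, 1}) (h0 : f 0 = c₂ • X 2 + Q)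
    (h1 : f 1 = c₁ • X 1 + C d₁) (h2 : f 2 = c₀ • X 0 + Polynomial.aeval (X 1) P) :
    LeOneOrQuadratic l := by
  rcases le_or_gt (Q.degreeOf 0) 1 with he | he
  · refine Or.inl (le_of_forall_gt_imp_ge_of_dense fun θ hθ => ?_)
    exact hl.le_of_fibration hQ h0 h1 h2 hθ.le ((Nat.cast_le_one.2 he).trans_lt hθ)
  · have hle : l ≤ Q.degreeOf 0 := le_of_forall_gt_imp_ge_of_dense fun θ hθ =>
      hl.le_of_fibration hQ h0 h1 h2 ((Nat.one_lt_cast.2 he).trans hθ).le hθ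
    rw [hle.antisymm (hl.degreeOf_le_of_fibration hc₁ hQ h0 h1 h2 he)]
    exact LeOneOrQuadratic.natCast _

end Fibration

section Shift

theorem shift_mem_weightLE (hQ : Q ∈ supported k {0, 1}) (h0 : f 0 = c₂ • X 2 + Q)
    (h1 : f 1 = c₁ • X 1 + Polynomial.aeval (X 0) P) {θ : ℝ} (hθ : 1 ≤ θ)
    (h2 : f 2 ∈ weightLE k ![θ, P.natDegree, 1] θ)
    (hQθ : ∀ m, coeff m Q ≠ 0 → m 0 * θ + m 1 * P.natDegree ≤ θ * θ) (i : Fin 3) :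
    f i ∈ weightLE k ![θ, P.natDegree, 1] (θ * ![θ, P.natDegree, 1] i) := by
  match i with
  | 0 =>
    rw [h0]
    exact add_mem (smul_X_mem_weightLE _ (one_le_mul_of_one_le_of_one_le hθ hθ))
      ((mem_weightLE_vec_three_iff hQ).2 hQθ)
  | 1 =>
    rw [h1]
    exact add_mem (smul_X_mem_weightLE _ (le_mul_of_one_le_left P.natDegree.cast_nonneg hθ))
      (aeval_X_mem_weightLE (zero_le_one.trans hθ) (mul_comm _ _).le)
  | 2 => exact weightLE_mono (mul_one θ).ge h2

theorem IsDynamicalDegree.ge_of_shift (hl : IsDynamicalDegree f l)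
    (hQ : Q ∈ supported k {0, 1}) (h0 : f 0 = c₂ • X 2 + Q)
    (h1 : f 1 = c₁ • X 1 + Polynomial.aeval (X 0) P) (hP : P.natDegree ≠ 0) {θ : ℝ} (hθ : 1 < θ)
    (h2 : f 2 ∈ weightLE k ![θ, P.natDegree, 1] θ)
    (hQθ : ∀ m, coeff m Q ≠ 0 → m 0 * θ + m 1 * P.natDegree ≤ θ * θ)
    {m : Fin 3 →₀ ℕ} (hm : coeff m Q ≠ 0) (hmθ : m 0 * θ + m 1 * P.natDegree = θ * θ) : θ ≤ l := by
  have hP0 : (0 : ℝ) < P.natDegree := Nat.cast_pos.2 (Nat.pos_of_ne_zero hP)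
  have hθ0 : 0 < θ := zero_lt_one.trans hθ
  set μ : Fin 3 → ℝ := ![θ, P.natDegree, 1]
  have htop0 : leadingPart μ θ f 0 = weightedHomogeneousComponent μ (θ * θ) Q :=
    leadingPart_eq_of_eq_smul_X_add h0 (one_lt_mul_of_lt_of_le hθ hθ.le).ne
  have htop1 : leadingPart μ θ f 1 = P.leadingCoeff • X 0 ^ P.natDegree := by
    rw [leadingPart_eq_of_eq_smul_X_add h1 (lt_mul_of_one_lt_left hP0 hθ).ne, mul_comm]
    exact (hasTop_aeval_X (μ := μ) (i := 0) hθ0 P).weightedHomogeneousComponent_eq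
  have hm01 : ∃ i ∈ ({0, 1} : Set (Fin 3)), m i ≠ 0 := by
    by_contra! h
    rw [h 0 (by simp), h 1 (by simp), Nat.cast_zero, zero_mul, zero_mul, add_zero] at hmθ
    exact (mul_pos hθ0 hθ0).ne hmθ
  obtain ⟨i, hi, hmi⟩ := hm01
  refine hl.ge_of_weight hθ0 (shift_mem_weightLE hQ h0 h1 hθ.le h2 hQθ) (i := 0) hθ0
    (iter_ne_zero_of_shift (j := 1) ?_ ?_ (by decide) ?_ ?_)
  · rw [htop0]
    exact weightedHomogeneousComponent_mem_supported hQ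
  · rw [htop0]
    exact weightedHomogeneousComponent_notMem_supported hm
      ((weight_vec_three_of_mem_supported hQ hm).trans hmθ) hmi (fun h => h hi)
  · rw [htop1]
    exact Subalgebra.smul_mem _ (pow_mem (X_mem_supported.2 (Set.mem_singleton 0)) _) _
  · rw [htop1]
    exact smul_X_pow_notMem_supported_compl
      (Polynomial.leadingCoeff_ne_zero.2 (by rintro rfl; exact hP rfl)) hP 0

theorem IsDynamicalDegree.leOneOrQuadratic_of_shift (hl : IsDynamicalDegree f l)
    (hQ : Q ∈ supported k {0, 1}) (h0 : f 0 = c₂ • X 2 + Q)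
    (h1 : f 1 = c₁ • X 1 + Polynomial.aeval (X 0) P) (hP : P.natDegree ≠ 0)
    (h2 : ∀ θ : ℝ, 1 ≤ θ → f 2 ∈ weightLE k ![θ, P.natDegree, 1] θ) : LeOneOrQuadratic l := by
  have hP0 : (0 : ℝ) < P.natDegree := Nat.cast_pos.2 (Nat.pos_of_ne_zero hP)
  have hle {θ : ℝ} (hθ : 1 ≤ θ)
      (hQθ : ∀ m, coeff m Q ≠ 0 → m 0 * θ + m 1 * P.natDegree ≤ θ * θ) : l ≤ θ :=
    have hθ0 : 0 < θ := zero_lt_one.trans_le hθ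
    hl.le_of_weight hθ0.le (fun | 0 => hθ0 | 1 => hP0 | 2 => one_pos)
      (shift_mem_weightLE hQ h0 h1 hθ (h2 θ hθ) hQθ)
  by_cases! hQ1 : ∃ m ∈ Q.support, (1 : ℝ) < m 0 + m 1 * P.natDegree
  · obtain ⟨θ, hθ, hQθ, m, hm, hmθ⟩ := exists_one_lt_forall_le_sq_and_eq
      (fun m _ => by positivity) hQ1
    simp only [mem_support_iff, sq] at hQθ hm hmθ
    refine Or.inr ⟨m 0, m 1 * P.natDegree, ?_⟩
    rw [(hle hθ.le hQθ).antisymm (hl.ge_of_shift hQ h0 h1 hP hθ (h2 θ hθ.le) hQθ hm hmθ), sq, ← hmθ,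
      Nat.cast_mul]
  · refine Or.inl (hle le_rfl fun m hm => ?_)
    simpa only [mul_one] using hQ1 m (mem_support_iff.2 hm)

end Shift

end AffEnd

section LevelThree

variable {k : Type*} [Field k] {p : MvPolynomial (Fin 3) k}

theorem HasLevel.exists_eq_zero (h : HasLevel 0 p) : ∃ c d : k, c ≠ 0 ∧ p = c • X 0 + C d := by
  obtain ⟨c, hc, q, hq, rfl⟩ := h
  rw [show Set.Iio (0 : Fin 3) = ∅ from Set.ext (by decide), supported_empty, Algebra.mem_bot] at hq
  obtain ⟨d, rfl⟩ := hq
  exact ⟨c, d, hc, rfl⟩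

theorem HasLevel.exists_eq_one (h : HasLevel 1 p) :
    ∃ (c : k) (P : Polynomial k), c ≠ 0 ∧ p = c • X 1 + Polynomial.aeval (X 0) P := by
  obtain ⟨c, hc, q, hq, rfl⟩ := h
  rw [show Set.Iio (1 : Fin 3) = {0} from Set.ext (by decide), supported, Set.image_singleton,
    Algebra.adjoin_singleton_eq_range_aeval] at hq
  obtain ⟨P, rfl⟩ := hq
  exact ⟨c, P, hc, rfl⟩

theorem HasLevel.exists_eq_two (h : HasLevel 2 p) :
    ∃ c : k, ∃ q ∈ supported k {0, 1}, p = c • X 2 + q := by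
  obtain ⟨c, -, q, hq, rfl⟩ := h
  rw [show Set.Iio (2 : Fin 3) = {0, 1} from Set.ext (by decide)] at hq
  exact ⟨c, q, hq, rfl⟩

end LevelThree

theorem polynomial_aeval_mem {R A : Type*} [CommSemiring R] [Semiring A] [Algebra R A]
    {S : Subalgebra R A} {x : A} (hx : x ∈ S) (P : Polynomial R) : Polynomial.aeval x P ∈ S :=
  Algebra.adjoin_le (Set.singleton_subset_iff.2 hx) (Polynomial.aeval_mem_adjoin_singleton R x)

namespace AffEnd

variable {k : Type*} [Field k] {f : AffEnd k 3} {l : ℝ}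

theorem IsDynamicalDegree.leOneOrQuadratic_of_hasLevel_zero_two_one (hl : IsDynamicalDegree f l)
    (h0 : HasLevel 0 (f 0)) (h1 : HasLevel 2 (f 1)) (h2 : HasLevel 1 (f 2)) :
    LeOneOrQuadratic l := by
  obtain ⟨c₀, d₀, hc₀, h0⟩ := h0.exists_eq_zero
  obtain ⟨c₂, Q, hQ, h1⟩ := h1.exists_eq_two
  obtain ⟨c₁, P, -, h2⟩ := h2.exists_eq_one
  let β : AffEnd k 3 := ![X 1, X 0, X 2]
  have hβ : comp β β = one k 3 := by
    funext i
    fin_cases i <;> exact aeval_X _ _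
  have hQβ : aeval β Q ∈ supported k {0, 1} := aeval_mem_of_mem_supported hQ fun
    | 0, _ => X_mem_supported.2 (.inr rfl)
    | 1, _ => X_mem_supported.2 (.inl rfl)
  refine (hl.conj hβ hβ).leOneOrQuadratic_of_fibration (c₂ := c₂) (c₁ := c₀) (c₀ := c₁) (d₁ := d₀)
    (P := P) hc₀ hQβ ?_ ?_ ?_
  · simp [comp, β, h1]
  · simp [comp, β, h0, algHom_C]
  · simp [comp, β, h2, ← Polynomial.aeval_algHom_apply]

theorem IsDynamicalDegree.leOneOrQuadratic_of_hasLevel_one_zero_two (hl : IsDynamicalDegree f l)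
    (h0 : HasLevel 1 (f 0)) (h1 : HasLevel 0 (f 1)) (h2 : HasLevel 2 (f 2)) :
    LeOneOrQuadratic l := by
  obtain ⟨c₁, P, -, h0⟩ := h0.exists_eq_one
  obtain ⟨c₀, d₀, -, h1⟩ := h1.exists_eq_zero
  obtain ⟨c₂, Q, hQ, h2⟩ := h2.exists_eq_two
  exact hl.leOneOrQuadratic_of_planar hQ h0 h1 h2

theorem comp_swap_shear_eq_one {c : k} (hc : c ≠ 0) (P : Polynomial k) :
    let β : AffEnd k 3 := ![c • X 1 + Polynomial.aeval (X 0) P, X 0, X 2]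
    let β' : AffEnd k 3 := ![X 1, c⁻¹ • (X 0 - Polynomial.aeval (X 1) P), X 2]
    comp β β' = one k 3 ∧ comp β' β = one k 3 := by
  refine ⟨funext fun i => ?_, funext fun i => ?_⟩ <;> fin_cases i <;>
    simp [comp, one, hc, ← Polynomial.aeval_algHom_apply]

/-- Conjugation by `(f₀, x₀, x₂)` turns `f` into a map whose component `1` is `x₀`. -/
theorem IsDynamicalDegree.leOneOrQuadratic_of_hasLevel_one_two_zero (hl : IsDynamicalDegree f l)
    (h0 : HasLevel 1 (f 0)) (h1 : HasLevel 2 (f 1)) (h2 : HasLevel 0 (f 2)) :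
    LeOneOrQuadratic l := by
  obtain ⟨c₁, P, hc₁, h0⟩ := h0.exists_eq_one
  obtain ⟨c₂, Q, hQ, h1⟩ := h1.exists_eq_two
  obtain ⟨c₀, d₀, -, h2⟩ := h2.exists_eq_zero
  let β : AffEnd k 3 := ![f 0, X 0, X 2]
  let β' : AffEnd k 3 := ![X 1, c₁⁻¹ • (X 0 - Polynomial.aeval (X 1) P), X 2]
  obtain ⟨hβ, hβ'⟩ : comp β β' = one k 3 ∧ comp β' β = one k 3 := by
    simpa only [β, h0] using comp_swap_shear_eq_one hc₁ P
  have hf0 : aeval β' (f 0) = X 0 := congrFun hβ 0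
  have hX0 : X 0 ∈ supported k {(0 : Fin 3), 1} := X_mem_supported.2 (.inl rfl)
  have hX1 : X 1 ∈ supported k {(0 : Fin 3), 1} := X_mem_supported.2 (.inr rfl)
  have hQβ : aeval β' Q ∈ supported k {0, 1} := aeval_mem_of_mem_supported hQ fun
    | 0, _ => hX1
    | 1, _ => Subalgebra.smul_mem _ (sub_mem hX0 (polynomial_aeval_mem hX1 P)) _
  refine (hl.conj hβ hβ').leOneOrQuadratic_of_shift (c₂ := c₁ * c₂) (c₁ := 0) (P := .X)
    (add_mem (Subalgebra.smul_mem _ hQβ c₁) (polynomial_aeval_mem hX0 P)) ?_ ?_ ?_ fun θ hθ => ?_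
  · calc aeval β' (aeval f (f 0)) = c₁ • aeval β' (f 1) + Polynomial.aeval (aeval β' (f 0)) P := by
          conv_lhs => rw [h0]
          simp [← Polynomial.aeval_algHom_apply]
      _ = (c₁ * c₂) • X 2 + (c₁ • aeval β' Q + Polynomial.aeval (X 0) P) := by
          rw [hf0, h1, map_add, map_smul, aeval_X, smul_add, smul_smul, add_assoc]
          rfl
  · rw [Polynomial.aeval_X, zero_smul, zero_add, ← hf0]
    exact congrArg (aeval β') (aeval_X f 0)
  · exact Polynomial.natDegree_X.trans_ne one_ne_zero
  · have hf2 : comp (comp β f) β' 2 = c₀ • X 1 + C d₀ := by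
      simp [comp, β, β', h2, algHom_C]
    rw [hf2, Polynomial.natDegree_X, Nat.cast_one]
    exact add_mem (smul_X_mem_weightLE _ hθ) (C_mem_weightLE _ (zero_le_one.trans hθ))

theorem IsDynamicalDegree.leOneOrQuadratic_of_hasLevel_two_zero_one (hl : IsDynamicalDegree f l)
    (h0 : HasLevel 2 (f 0)) (h1 : HasLevel 0 (f 1)) (h2 : HasLevel 1 (f 2)) :
    LeOneOrQuadratic l := by
  obtain ⟨c₂, Q, hQ, h0⟩ := h0.exists_eq_two
  obtain ⟨c₀, d₀, hc₀, h1⟩ := h1.exists_eq_zero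
  obtain ⟨c₁, P, -, h2⟩ := h2.exists_eq_one
  let R : Polynomial k := P.comp (c₀⁻¹ • (Polynomial.X - Polynomial.C d₀))
  have hR : Polynomial.aeval (f 1) R = Polynomial.aeval (X 0) P := by
    simp [R, h1, Polynomial.aeval_comp, hc₀, algebraMap_eq]
  let β : AffEnd k 3 := ![X 0, X 1, X 2 - Polynomial.aeval (X 1) R]
  let β' : AffEnd k 3 := ![X 0, X 1, X 2 + Polynomial.aeval (X 1) R]
  have hβ : comp β β' = one k 3 := by
    funext i
    fin_cases i <;> simp [comp, one, β, β', ← Polynomial.aeval_algHom_apply]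
  have hβ' : comp β' β = one k 3 := by
    funext i
    fin_cases i <;> simp [comp, one, β, β', ← Polynomial.aeval_algHom_apply]
  have hX1 : X 1 ∈ supported k {(0 : Fin 3), 1} := X_mem_supported.2 (.inr rfl)
  have hQβ : aeval β' Q ∈ supported k {0, 1} := aeval_mem_of_mem_supported hQ fun
    | 0, _ => X_mem_supported.2 (.inl rfl)
    | 1, _ => hX1
  refine (hl.conj hβ hβ').leOneOrQuadratic_of_shift (c₂ := c₂) (c₁ := 0)
    (P := Polynomial.C c₀ * Polynomial.X + Polynomial.C d₀)
    (add_mem (Subalgebra.smul_mem _ (polynomial_aeval_mem hX1 R) c₂) hQβ) ?_ ?_ ?_ fun θ hθ => ?_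
  · simp [comp, β, β', h0, add_assoc]
  · simp [comp, β, β', h1, algHom_C, C_mul']
  · exact (Polynomial.natDegree_linear hc₀).trans_ne one_ne_zero
  · have hf2 : comp (comp β f) β' 2 = c₁ • X 1 := by
      rw [comp, comp, show β 2 = X 2 - Polynomial.aeval (X 1) R from rfl, map_sub, aeval_X,
        ← Polynomial.aeval_algHom_apply, aeval_X, hR, h2, add_sub_cancel_right, map_smul, aeval_X]
      rfl
    rw [hf2, Polynomial.natDegree_linear hc₀, Nat.cast_one]
    exact smul_X_mem_weightLE _ hθ

theorem IsDynamicalDegree.leOneOrQuadratic_of_hasLevel_two_one_zero (hl : IsDynamicalDegree f l)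
    (h0 : HasLevel 2 (f 0)) (h1 : HasLevel 1 (f 1)) (h2 : HasLevel 0 (f 2)) :
    LeOneOrQuadratic l := by
  obtain ⟨c₂, Q, hQ, h0⟩ := h0.exists_eq_two
  obtain ⟨c₁, P, hc₁, h1⟩ := h1.exists_eq_one
  obtain ⟨c₀, d₀, -, h2⟩ := h2.exists_eq_zero
  by_cases hP : P.natDegree = 0
  · obtain ⟨d, rfl⟩ := Polynomial.natDegree_eq_zero.1 hP
    rw [Polynomial.aeval_C] at h1
    exact hl.leOneOrQuadratic_of_fibration (P := .C d₀) hc₁ hQ h0 h1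
      (by rw [h2, Polynomial.aeval_C, algebraMap_eq])
  · refine hl.leOneOrQuadratic_of_shift hQ h0 h1 hP fun θ hθ => ?_
    rw [h2]
    exact add_mem (smul_X_mem_weightLE _ le_rfl) (C_mem_weightLE _ (zero_le_one.trans hθ))

theorem injective_fin_three_cases : ∀ π : Fin 3 → Fin 3, Function.Injective π →
    (π 0 = 0 ∧ π 1 = 1 ∧ π 2 = 2) ∨ (π 0 = 0 ∧ π 1 = 2 ∧ π 2 = 1) ∨
    (π 0 = 1 ∧ π 1 = 0 ∧ π 2 = 2) ∨ (π 0 = 1 ∧ π 1 = 2 ∧ π 2 = 0) ∨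
    (π 0 = 2 ∧ π 1 = 0 ∧ π 2 = 1) ∨ (π 0 = 2 ∧ π 1 = 1 ∧ π 2 = 0) := by
  decide

theorem IsDynamicalDegree.leOneOrQuadratic_of_hasLevel (hl : IsDynamicalDegree f l)
    {π : Fin 3 → Fin 3} (hπ : Function.Injective π) (hf : ∀ i, HasLevel (π i) (f i)) :
    LeOneOrQuadratic l := by
  obtain ⟨h0, h1, h2⟩ | ⟨h0, h1, h2⟩ | ⟨h0, h1, h2⟩ | ⟨h0, h1, h2⟩ | ⟨h0, h1, h2⟩ | ⟨h0, h1, h2⟩ :=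
    injective_fin_three_cases π hπ <;>
  have hf0 := h0 ▸ hf 0 <;> have hf1 := h1 ▸ hf 1 <;> have hf2 := h2 ▸ hf 2
  · exact .inl (hl.le_one_of_hasLevel fun | 0 => hf0 | 1 => hf1 | 2 => hf2)
  · exact hl.leOneOrQuadratic_of_hasLevel_zero_two_one hf0 hf1 hf2
  · exact hl.leOneOrQuadratic_of_hasLevel_one_zero_two hf0 hf1 hf2
  · exact hl.leOneOrQuadratic_of_hasLevel_one_two_zero hf0 hf1 hf2
  · exact hl.leOneOrQuadratic_of_hasLevel_two_zero_one hf0 hf1 hf2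
  · exact hl.leOneOrQuadratic_of_hasLevel_two_one_zero hf0 hf1 hf2

theorem IsDynamicalDegree.leOneOrQuadratic (hl : IsDynamicalDegree f l) (hf : IsAutomorphism f)
    (hf' : IsAffineTriangular f) : LeOneOrQuadratic l := by
  obtain ⟨β, β', π, hβ, hβ', hπ, hlevel⟩ := exists_conj_hasLevel hf hf'
  exact (hl.conj hβ hβ').leOneOrQuadratic_of_hasLevel hπ hlevel

end AffEnd

section MonomialEndomorphisms

theorem HasTop.X_add_prod_X_pow {σ ι R M : Type*} [Fintype ι] [CommRing R] [AddCommMonoid M]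
    [PartialOrder M] [IsOrderedCancelAddMonoid M] {μ : σ → M} {s : M} {i : σ} (v : ι → σ)
    (e : ι → ℕ) (hi : μ i < s) (hs : ∑ j, e j • μ (v j) = s) :
    HasTop μ s (MvPolynomial.X i + ∏ j, MvPolynomial.X (v j) ^ e j)
      (monomial (∑ j, Finsupp.single (v j) (e j)) (1 : R)) := by
  rw [add_comm, monomial_sum_one, ← hs]
  refine HasTop.add_right ?_ (weightLE_le_weightLT (hi.trans_eq hs.symm) (X_mem_weightLE le_rfl))
  simp only [← X_pow_eq_monomial]
  exact HasTop.prod fun j _ => (HasTop.X (v j)).pow (e j)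

namespace AffEnd

variable {k : Type*} [Field k] {n : ℕ}

/-- The shift-like endomorphism `(x_{n+1} + p(x_1, …, x_n), x_1, …, x_n)` attached to `p`. -/
noncomputable def shift (p : MvPolynomial (Fin n) k) : AffEnd k (n + 1) :=
  Fin.cons (X (Fin.last n) + rename Fin.castSucc p) fun i => X i.castSucc

theorem isShiftLike_shift (p : MvPolynomial (Fin n) k) : (shift p).IsShiftLike :=
  ⟨p, rfl⟩

theorem isAutomorphism_shift (p : MvPolynomial (Fin n) k) : (shift p).IsAutomorphism := by
  refine ⟨Fin.snoc (fun i => X i.succ) (X 0 - rename Fin.succ p), funext fun i => ?_,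
    funext fun i => ?_⟩
  · induction i using Fin.cases with
    | zero =>
      have hcast : (Fin.snoc (fun i => X i.succ) (X 0 - rename Fin.succ p) : AffEnd k (n + 1)) ∘
          Fin.castSucc = X ∘ Fin.succ := funext fun i => Fin.snoc_castSucc ..
      rw [comp, shift, Fin.cons_zero, map_add, aeval_X, Fin.snoc_last, aeval_rename, hcast,
        ← rename_eq_aeval, sub_add_cancel, one]
    | succ i => rw [comp, shift, Fin.cons_succ, aeval_X, Fin.snoc_castSucc, one]
  · induction i using Fin.lastCases with
    | last =>
      have hsucc : shift p ∘ Fin.succ = X ∘ Fin.castSucc := rfl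
      rw [comp, Fin.snoc_last, map_sub, aeval_X, aeval_rename, hsucc, ← rename_eq_aeval, shift,
        Fin.cons_zero, add_sub_cancel_right, one]
    | cast i => rw [comp, Fin.snoc_castSucc, aeval_X, shift, Fin.cons_succ, one]

theorem isDynamicalDegree_shift_prod {l : ℝ} (hl : 1 < l) {e : Fin n → ℕ}
    (h : l ^ n = ∑ i, e i * l ^ (i.rev : ℕ)) :
    IsDynamicalDegree (shift (∏ i, X i ^ e i : MvPolynomial (Fin n) k)) l := by
  have hl0 : 0 < l := zero_lt_one.trans hl
  refine isDynamicalDegree_of_hasTop_monomial (μ := fun i => l ^ (i.rev : ℕ)) hl0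
    (fun i => pow_pos hl0 _) fun i => ?_
  induction i using Fin.cases with
  | zero =>
    simp only [shift, Fin.cons_zero, map_prod, map_pow, rename_X, ← pow_succ']
    refine ⟨_, 1, one_ne_zero, HasTop.X_add_prod_X_pow _ _ (pow_lt_pow_right₀ hl ?_) ?_⟩
    · rw [Fin.rev_last, Fin.val_zero]
      exact Nat.succ_pos _
    · simp only [nsmul_eq_mul, Fin.rev_zero, Fin.val_last, Fin.rev_castSucc, Fin.val_succ,
        pow_succ, h, Finset.sum_mul, mul_assoc]
  | succ i =>
    refine ⟨Finsupp.single i.castSucc 1, 1, one_ne_zero, ?_⟩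
    rw [Fin.rev_succ, Fin.val_castSucc, ← pow_succ', ← Fin.val_succ, ← Fin.rev_castSucc]
    exact HasTop.X i.castSucc

theorem shift_fin_two (a b : ℕ) :
    shift (∏ i, X i ^ ![a, b] i : MvPolynomial (Fin 2) k) =
      ![X 2 + X 0 ^ a * X 1 ^ b, X 0, X 1] := by
  funext i
  match i with
  | 0 => simp [shift, Fin.prod_univ_two]
  | 1 => rfl
  | 2 => rfl

theorem isAutomorphism_ofMatrix (A : Matrix (Fin n) (Fin n) ℕ) :
    (ofMatrix k A).IsAutomorphism := by
  refine ⟨Fin.append (fun j => X (Fin.natAdd n j))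
    fun j => X (Fin.castAdd n j) - ∏ i, X (Fin.natAdd n i) ^ A j i,
    funext fun i => ?_, funext fun i => ?_⟩ <;>
  induction i using Fin.addCases <;>
  simp only [comp, one, ofMatrix, Fin.append_left, Fin.append_right, map_add, map_sub, map_prod,
    map_pow, aeval_X, sub_add_cancel, add_sub_cancel_right]

theorem isPermutationTriangular_ofMatrix (A : Matrix (Fin n) (Fin n) ℕ) :
    (ofMatrix k A).IsPermutationTriangular := by
  refine ⟨fun i => X (finAddFlip i), Fin.append (fun j => X (Fin.castAdd n j))
    fun j => X (Fin.natAdd n j) + ∏ i, X (Fin.castAdd n i) ^ A j i,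
    EquivLike.range_comp X (finAddFlip (m := n) (n := n)), fun i => ?_, funext fun i => ?_⟩
  · induction i using Fin.addCases with
    | left j => rw [Fin.append_left]; exact X_mem_supported.2 (Set.mem_ofPred.2 le_rfl)
    | right j =>
      rw [Fin.append_right]
      have hle (i : Fin n) : Fin.castAdd n i ∈ {m | m ≤ Fin.natAdd n j} :=
        Fin.le_def.2 (i.is_lt.le.trans (Nat.le_add_right n j))
      exact add_mem (X_mem_supported.2 (Set.mem_ofPred.2 le_rfl))
        (prod_mem fun i _ => pow_mem (X_mem_supported.2 (hle i)) _)
  · induction i using Fin.addCases with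
    | left j => rw [ofMatrix, comp, aeval_X, finAddFlip_apply_castAdd, Fin.append_left,
        Fin.append_right]
    | right j => rw [ofMatrix, comp, aeval_X, finAddFlip_apply_natAdd, Fin.append_left,
        Fin.append_right]

theorem isDynamicalDegree_ofMatrix [NeZero n] {A : Matrix (Fin n) (Fin n) ℕ} {l : ℝ}
    {v : Fin n → ℝ} (hl : 1 < l) (hv : ∀ i, 0 < v i)
    (h : (A.map fun m => (m : ℝ)).mulVec v = l • v) : (ofMatrix k A).IsDynamicalDegree l := by
  have hl0 : 0 < l := zero_lt_one.trans hl
  refine isDynamicalDegree_of_hasTop_monomial (μ := Fin.append v (l⁻¹ • v)) hl0 (fun i => ?_)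
    fun i => ?_
  · induction i using Fin.addCases with
    | left j => rw [Fin.append_left]; exact hv j
    | right j => rw [Fin.append_right]; exact mul_pos (inv_pos.2 hl0) (hv j)
  · induction i using Fin.addCases with
    | left j =>
      rw [ofMatrix, Fin.append_left, Fin.append_left]
      refine ⟨_, 1, one_ne_zero, HasTop.X_add_prod_X_pow _ _ ?_ ?_⟩
      · rw [Fin.append_right, Pi.smul_apply, smul_eq_mul]
        exact mul_lt_mul_of_pos_right ((inv_lt_one_of_one_lt₀ hl).trans hl) (hv j)
      · simp only [Fin.append_left, nsmul_eq_mul]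
        exact congrFun h j
    | right j =>
      rw [ofMatrix, Fin.append_right, Fin.append_right]
      refine ⟨Finsupp.single (Fin.castAdd n j) 1, 1, one_ne_zero, ?_⟩
      rw [Pi.smul_apply, smul_eq_mul, mul_inv_cancel_left₀ hl0.ne',
        ← Fin.append_left v (l⁻¹ • v) j]
      exact HasTop.X (Fin.castAdd n j)

theorem ofMatrix_fin_two (A : Matrix (Fin 2) (Fin 2) ℕ) :
    ofMatrix k A =
      ![X 2 + X 0 ^ A 0 0 * X 1 ^ A 0 1, X 3 + X 0 ^ A 1 0 * X 1 ^ A 1 1, X 0, X 1] := by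
  funext i
  match i with
  | 0 => exact congrArg (X 2 + ·) (Fin.prod_univ_two _)
  | 1 => exact congrArg (X 3 + ·) (Fin.prod_univ_two _)
  | 2 => rfl
  | 3 => rfl

end AffEnd

end MonomialEndomorphisms

section Matrices

theorem isIrreducible_of_forall_pos {ι R : Type*} [Ring R] [LinearOrder R] {A : Matrix ι ι R}
    (hA : ∀ i j, 0 < A i j) : A.IsIrreducible :=
  let _ := A.toQuiver
  ⟨fun i j => (hA i j).le, fun i j => ⟨Quiver.Hom.toPath ⟨hA i j⟩, one_pos⟩⟩

variable {ι : Type*} [Fintype ι]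

theorem nnnorm_le_spectralRadius_of_mulVec_eq_smul [DecidableEq ι] {𝕜 : Type*} [NormedField 𝕜]
    {A : Matrix ι ι 𝕜} {v : ι → 𝕜} {z : 𝕜} (hv : v ≠ 0) (h : A.mulVec v = z • v) :
    (‖z‖₊ : ENNReal) ≤ spectralRadius 𝕜 A := by
  have hmem : z ∈ spectrum 𝕜 A := by
    rw [← Matrix.spectrum_toLin']
    exact (Module.End.hasEigenvalue_of_hasEigenvector
      ⟨Module.End.mem_eigenspace_iff.2 h, hv⟩).mem_spectrum
  exact le_iSup₂ (f := fun (z : 𝕜) (_ : z ∈ spectrum 𝕜 A) => (‖z‖₊ : ENNReal)) z hmem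

theorem map_natCast_mulVec_comp {R S : Type*} [Semiring R] [Semiring S] (f : R →+* S)
    {A : Matrix ι ι ℕ} {v : ι → R} {l : R}
    (h : (A.map fun m => (m : R)).mulVec v = l • v) :
    (A.map fun m => (m : S)).mulVec (f ∘ v) = f l • (f ∘ v) := by
  have hA : (A.map fun m => (m : R)).map f = A.map fun m => (m : S) := by
    rw [Matrix.map_map]
    exact congrArg A.map (funext fun m => map_natCast f m)
  funext i
  rw [← hA, ← RingHom.map_mulVec, h, Pi.smul_apply, smul_eq_mul, map_mul]
  rfl

theorem one_lt_spectralRadius_of_mulVec_eq_smul [DecidableEq ι] {A : Matrix ι ι ℕ} {v : ι → ℝ}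
    {l : ℝ} (hl : 1 < l) (hv : v ≠ 0) (h : (A.map fun m => (m : ℝ)).mulVec v = l • v) :
    1 < spectralRadius ℂ (A.map fun m => (m : ℂ)) := by
  have hv' : Complex.ofRealHom ∘ v ≠ 0 := fun h0 =>
    hv (funext fun i => Complex.ofReal_eq_zero.1 (congrFun h0 i))
  have hnorm : 1 < ‖(l : ℂ)‖₊ := by
    rw [← NNReal.coe_lt_coe, coe_nnnorm, Complex.norm_real]
    exact hl.trans_le (le_abs_self l)
  exact (ENNReal.one_lt_coe_iff.2 hnorm).trans_le
    (nnnorm_le_spectralRadius_of_mulVec_eq_smul hv' (map_natCast_mulVec_comp _ h))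

theorem exists_pos_mulVec_eq_smul {l : ℝ} {u c w : ℤ} (hu : 0 < u) (hc : 0 < c) (hw : 0 < w)
    (hul : u < l) (h : (l - u) * (l - w) = c) :
    ∃ A : Matrix (Fin 2) (Fin 2) ℕ, A.map (fun m => (m : ℤ)) = !![u, 1; c, w] ∧
      (∀ i j, 0 < A i j) ∧
      ∃ v : Fin 2 → ℝ, (∀ i, 0 < v i) ∧ (A.map fun m => (m : ℝ)).mulVec v = l • v := by
  lift u to ℕ using hu.le
  lift c to ℕ using hc.le
  lift w to ℕ using hw.le
  rw [Int.natCast_pos] at hu hc hw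
  refine ⟨!![u, 1; c, w], ?_, fun i j => ?_, ![1, l - u], fun i => ?_, ?_⟩
  · ext i j; fin_cases i <;> fin_cases j <;> simp
  · fin_cases i <;> fin_cases j <;> first | assumption | exact one_pos
  · fin_cases i <;> first | exact sub_pos.2 hul | exact one_pos
  · ext i
    push_cast at h
    fin_cases i
    · simp [Matrix.mulVec, dotProduct]
    · simp only [Matrix.mulVec, dotProduct, Fin.mk_one, Fin.isValue, Matrix.map_apply,
        Matrix.of_apply, Matrix.cons_val', Matrix.cons_val_fin_one, Matrix.cons_val_one,
        Fin.sum_univ_two, Matrix.cons_val_zero, mul_one, Pi.smul_apply, smul_eq_mul]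
      linear_combination -h

end Matrices

section QuadraticWeakPerron

variable {l : ℝ} {a b : ℤ}

theorem sq_eq_of_minpoly_eq (hmin : minpoly ℚ l =
    Polynomial.X ^ 2 - Polynomial.C (a : ℚ) * Polynomial.X - Polynomial.C (b : ℚ)) :
    l ^ 2 = a * l + b := by
  have h := minpoly.aeval ℚ l
  simp only [hmin, map_sub, map_pow, map_mul, Polynomial.aeval_X, Polynomial.aeval_C,
    eq_ratCast, Rat.cast_intCast] at h
  linarith

theorem irrational_of_minpoly_eq (hmin : minpoly ℚ l =
    Polynomial.X ^ 2 - Polynomial.C (a : ℚ) * Polynomial.X - Polynomial.C (b : ℚ)) :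
    Irrational l := by
  have hdeg : (minpoly ℚ l).natDegree = 2 := by rw [hmin]; compute_degree!
  rintro ⟨q, rfl⟩
  have hone := minpoly.natDegree_eq_one_iff.2 (⟨q, rfl⟩ : (q : ℝ) ∈ (algebraMap ℚ ℝ).range)
  omega

theorem IsWeakPerron.abs_sub_le (hl : IsWeakPerron l) (hmin : minpoly ℚ l =
    Polynomial.X ^ 2 - Polynomial.C (a : ℚ) * Polynomial.X - Polynomial.C (b : ℚ)) :
    |(a : ℝ) - l| ≤ l := by
  have hroot : ((a : ℝ) - l) ^ 2 - a * (a - l) - b = 0 := by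
    linear_combination sq_eq_of_minpoly_eq hmin
  rw [← Real.norm_eq_abs, ← Complex.norm_real]
  refine hl.2.2 _ ?_
  rw [hmin]
  simpa using congrArg Complex.ofReal hroot

theorem coeff_eq_of_irrational (hl : Irrational l) {a' b' : ℤ} (h : a * l + b = a' * l + b') :
    a = a' ∧ b = b' := by
  have ha : a = a' := by
    by_contra hne
    exact (hl.intCast_mul (sub_ne_zero.2 hne)).ne_int (b' - b) (by push_cast; linarith)
  subst ha
  exact ⟨rfl, by exact_mod_cast add_left_cancel h⟩

theorem half_lt_of_sq_eq (hl : Irrational l) (hsq : l ^ 2 = a * l + b) (ha : a ≤ 2 * l) :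
    ((a - a / 2 : ℤ) : ℝ) < l := by
  have hdisc : (2 * l - a) ^ 2 = ((a ^ 2 + 4 * b : ℤ) : ℝ) := by
    push_cast
    linear_combination 4 * hsq
  have hirr : Irrational (2 * l - a) := by
    exact_mod_cast (hl.intCast_mul two_ne_zero).sub_intCast a
  have hpos : 0 < a ^ 2 + 4 * b := by
    have : 0 < (2 * l - a) ^ 2 := sq_pos_of_ne_zero (by simpa using hirr.ne_int 0)
    rw [hdisc] at this
    exact_mod_cast this
  have hone : 1 < 2 * l - a := by
    refine lt_of_le_of_ne ?_ (by simpa using (hirr.ne_int 1).symm)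
    rw [← one_le_sq_iff₀ (by linarith), hdisc]
    exact_mod_cast hpos
  have hhalf : 2 * ((a - a / 2 : ℤ) : ℝ) ≤ a + 1 := by
    exact_mod_cast (by omega : 2 * (a - a / 2) ≤ a + 1)
  linarith

theorem exists_pos_matrix_of_sq_eq (hl : Irrational l) (h1 : 1 < l) (hsq : l ^ 2 = a * l + b)
    (ha : a ≤ 2 * l) (hb : b < 0) :
    ∃ A : Matrix (Fin 2) (Fin 2) ℕ,
      A.map (fun m => (m : ℤ)) = !![a / 2, 1; a / 2 * (a - a / 2) + b, a - a / 2] ∧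
      (∀ i j, 0 < A i j) ∧
      ∃ v : Fin 2 → ℝ, (∀ i, 0 < v i) ∧ (A.map fun m => (m : ℝ)).mulVec v = l • v := by
  set u := a / 2
  set w := a - u
  have hw : (w : ℝ) < l := half_lt_of_sq_eq hl hsq ha
  have hu : (u : ℝ) < l := hw.trans_le' (by exact_mod_cast (by omega : u ≤ w))
  have hu0 : 0 < u := by
    have hb' : (b : ℝ) < 0 := by exact_mod_cast hb
    have : (1 : ℝ) < a := h1.trans (by nlinarith)
    have : 1 < a := by exact_mod_cast this
    omega
  have hdet : (l - u) * (l - w) = ((u * w + b : ℤ) : ℝ) := by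
    push_cast [w]
    linear_combination hsq
  have hc : 0 < u * w + b := by
    have := mul_pos (sub_pos.2 hu) (sub_pos.2 hw)
    rw [hdet] at this
    exact_mod_cast this
  exact exists_pos_mulVec_eq_smul hu0 hc (by omega) hu hdet

end QuadraticWeakPerron

theorem mainTheorem9 (k : Type*) [Field k] (l : ℝ) (hl : IsWeakPerron l) (a b : ℤ)
    (hmin : minpoly ℚ l =
      Polynomial.X ^ 2 - Polynomial.C (a : ℚ) * Polynomial.X - Polynomial.C (b : ℚ)) :
    0 ≤ a ∧
    (0 ≤ b → ∃ f : AffEnd k 3,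
      f = ![X 2 + X 0 ^ a.toNat * X 1 ^ b.toNat, X 0, X 1] ∧
      f.IsShiftLike ∧ f.IsAutomorphism ∧ f.IsDynamicalDegree l) ∧
    (b < 0 →
      (∀ f : AffEnd k 3, f.IsAutomorphism → f.IsAffineTriangular → ¬ f.IsDynamicalDegree l) ∧
      ∃ A : Matrix (Fin 2) (Fin 2) ℕ,
        A.map (fun m => (m : ℤ)) = !![a / 2, 1; a / 2 * (a - a / 2) + b, a - a / 2] ∧
        (A.map (fun m => (m : ℝ))).IsIrreducible ∧
        1 < spectralRadius ℂ (A.map (fun m => (m : ℂ))) ∧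
        ∃ f : AffEnd k 4,
          f = ![X 2 + X 0 ^ A 0 0 * X 1 ^ A 0 1, X 3 + X 0 ^ A 1 0 * X 1 ^ A 1 1, X 0, X 1] ∧
          f = AffEnd.ofMatrix k A ∧
          f.IsAutomorphism ∧ f.IsPermutationTriangular ∧ f.IsDynamicalDegree l) := by
  have hsq := sq_eq_of_minpoly_eq hmin
  have hirr := irrational_of_minpoly_eq hmin
  have h1 : 1 < l := lt_of_le_of_ne hl.1 (by exact_mod_cast (hirr.ne_int 1).symm)
  obtain ⟨ha, ha'⟩ := abs_le.1 (hl.abs_sub_le hmin)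
  have ha0 : 0 ≤ a := by exact_mod_cast (by linarith : (0 : ℝ) ≤ a)
  refine ⟨ha0, fun hb => ?_, fun hb => ⟨fun f hf hft hfl => ?_, ?_⟩⟩
  · lift a to ℕ using ha0
    lift b to ℕ using hb
    refine ⟨AffEnd.shift (∏ i, X i ^ ![a, b] i), AffEnd.shift_fin_two a b,
      AffEnd.isShiftLike_shift _, AffEnd.isAutomorphism_shift _,
      AffEnd.isDynamicalDegree_shift_prod h1 ?_⟩
    simpa [Fin.sum_univ_two] using hsq
  · obtain hle | ⟨a', b', h⟩ := hfl.leOneOrQuadratic hf hft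
    · exact h1.not_ge hle
    · have := (coeff_eq_of_irrational hirr (b := b) (a' := a') (b' := b')
        (by exact_mod_cast hsq.symm.trans h)).2
      omega
  · obtain ⟨A, hA, hpos, v, hv, hAv⟩ :=
      exists_pos_matrix_of_sq_eq hirr h1 hsq (by linarith) hb
    exact ⟨A, hA, isIrreducible_of_forall_pos fun i j => Nat.cast_pos.2 (hpos i j),
      one_lt_spectralRadius_of_mulVec_eq_smul h1 (fun h0 => (hv 0).ne' (congrFun h0 0)) hAv,
      AffEnd.ofMatrix k A, AffEnd.ofMatrix_fin_two A, rfl, AffEnd.isAutomorphism_ofMatrix A,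
      AffEnd.isPermutationTriangular_ofMatrix A, AffEnd.isDynamicalDegree_ofMatrix h1 hv hAv⟩
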